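/- Let $r\ge 0$ and let $X, Y \subset \mathbb{P}^r_{\mathbb{C}}$ be reduced, possibly reducible, closed subschemes with $\dim X\le r-2$ and $\dim Y\le r-2$. Then $X$ and $Y$ are Cremona equivalent if and only if they are birational over $\mathbb{C}$. Here $X$ and $Y$ are birational over $\mathbb{C}$ if some dense open subscheme of $X$ is isomorphic, as a scheme over $\mathbb{C}$, to some dense open subscheme of $Y$. They are Cremona equivalent if there is a birational self-map $\omega\colon\mathbb{P}^r\dashrightarrow\mathbb{P}^r$ over $\mathbb{C}$ which is an isomorphism in a neighbourhood of the generic point of every irreducible component of $X$ and satisfies $\omega(X)=Y$, where $\omega(X)$ denotes the closure of the image of the part of $X$ on which $\omega$ is an isomorphism onto its image. -/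

import Mathlib

open AlgebraicGeometry CategoryTheory

noncomputable section

namespace Cremona

attribute [local instance] MvPolynomial.gradedAlgebra

/-- Projective space of dimension `r` over the complex numbers: `Proj ℂ[x₀, …, x_r]`. -/
abbrev ProjSpace (r : ℕ) : Scheme.{0} :=
  Proj (MvPolynomial.homogeneousSubmodule (Fin (r + 1)) ℂ)

/-- The structure morphism of projective space over `Spec ℂ`. -/
def structureMap (r : ℕ) : ProjSpace r ⟶ Spec (CommRingCat.of ℂ) :=
  Proj.toSpecZero (MvPolynomial.homogeneousSubmodule (Fin (r + 1)) ℂ) ≫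
    Spec.map (CommRingCat.ofHom
      (algebraMap ℂ (MvPolynomial.homogeneousSubmodule (Fin (r + 1)) ℂ 0)))

/-- The image of a set under a birational map given as an isomorphism between dense open
subschemes: the closure of the image of the part of the set where the map is defined. -/
def birationalImage {P Q : Scheme.{0}} (ω : P.PartialIso Q) (S : Set P) : Set Q :=
  closure {q | ∃ u : ω.source, ω.source.ι u ∈ S ∧ ω.target.ι (ω.iso.hom u) = q}

/-- The closed subschemes `i : X ⟶ ℙʳ` and `j : Y ⟶ ℙʳ` are Cremona equivalent: there is a
birational self-map `ω` of `ℙʳ` over `ℂ` which is an isomorphism at the generic point of every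
irreducible component of `X` and satisfies `ω(X) = Y`.

A birational map that is an isomorphism at each point of a finite set restricts to
an isomorphism from a single open set containing all of them onto an open set, so the condition
at the generic points is that they lie in the source of a suitable representative of `ω`.
No birationality of `X` and `Y` is built in. -/
def CremonaEquivalent {r : ℕ} {X Y : Scheme.{0}} (i : X ⟶ ProjSpace r) (j : Y ⟶ ProjSpace r) :
    Prop :=
  ∃ ω : (ProjSpace r).PartialIso (ProjSpace r),
    ω.IsOver (structureMap r) (structureMap r) ∧
    (∀ x ∈ genericPoints X, i x ∈ ω.source) ∧
    birationalImage ω (Set.range i) = Set.range j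

end Cremona

end

/-! If `ω` is a Cremona equivalence, the parts of `X` and `Y` on which it is an isomorphism are
closed subschemes of one open set with the same image. A reduced closed subscheme is determined by
its support, so these parts are isomorphic, and they are dense.

For the converse, a birational map identifies the residue fields `K i` at the generic points of `X`
with those at the generic points of `Y`. This gives two finite families of `K i`-valued points of
projective space, each without specializations between its members. Every tuple of coordinates
generates `K i`, and the transcendence degree is at most `r - 2`. It suffices to carry one family to
the other by an isomorphism of open subsets. A hyperplane avoiding all the points reduces this to
affine space, where the maps used are shears and the elementary maps `x_k ↦ x_k + g / h`, with `g`,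
`h` in the other variables.

If the projections forgetting `x_k` are still separated and generating, interpolation shows that
`x_k` can be given arbitrary values (`update_of_generatingTuples`). Two Noether normalizations
followed by a generic shear reach this situation for a coordinate `p`, which is then replaced by
distinct complex constants (`exists_prepared`). Now the points lie in distinct parallel hyperplanes
and can be translated independently. Generic translations keep the projections along the constant
coordinate separated, and that coordinate serves as temporary storage for changing any other one
(`update_of_dependent`). Finally both families are moved, coordinate by coordinate, to common
generic values (`of_prepared`). Each new value is a primitive element that makes the remaining
coordinates redundant, so the process can continue. -/

open MvPolynomial

/-! ### Matching points under isomorphisms of open subschemes. -/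

/-- Families of points of two `S`-schemes which correspond to each other under an isomorphism
between open subschemes. -/
def Linked {ι : Type} {P Q S : Scheme.{0}} (sP : P ⟶ S) (sQ : Q ⟶ S) (x : ι → P) (y : ι → Q) :
    Prop :=
  ∃ (U : Scheme.{0}) (f : U ⟶ P) (g : U ⟶ Q), IsOpenImmersion f ∧ IsOpenImmersion g ∧
    f ≫ sP = g ≫ sQ ∧ ∃ u : ι → U, (∀ i, f (u i) = x i) ∧ ∀ i, g (u i) = y i

namespace Linked

variable {ι : Type} {P Q R S : Scheme.{0}} {sP : P ⟶ S} {sQ : Q ⟶ S} {sR : R ⟶ S}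

theorem refl (sP : P ⟶ S) (x : ι → P) : Linked sP sP x x :=
  ⟨P, 𝟙 P, 𝟙 P, inferInstance, inferInstance, rfl, x, fun _ => rfl, fun _ => rfl⟩

theorem symm {x : ι → P} {y : ι → Q} (h : Linked sP sQ x y) : Linked sQ sP y x := by
  obtain ⟨U, f, g, hf, hg, e, u, hx, hy⟩ := h
  exact ⟨U, g, f, hg, hf, e.symm, u, hy, hx⟩

/-- The fibre product of the two open immersions into `Q` is the intersection of their images, and
it contains a point over each pair `u i`, `v i`. No density is demanded in `Linked`, so nothing else
has to be checked. -/
theorem trans {x : ι → P} {y : ι → Q} {z : ι → R} (h : Linked sP sQ x y)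
    (h' : Linked sQ sR y z) : Linked sP sR x z := by
  obtain ⟨U, f, g, hf, hg, e, u, hx, hy⟩ := h
  obtain ⟨V, f', g', hf', hg', e', v, hx', hy'⟩ := h'
  have key : ∀ i, ∃ w : ↥(Limits.pullback g f'),
      Limits.pullback.fst g f' w = u i ∧ Limits.pullback.snd g f' w = v i := fun i =>
    Scheme.Pullback.exists_preimage_pullback (f := g) (g := f') (u i) (v i)
      ((hy i).trans (hx' i).symm)
  choose w hw hw' using key
  refine ⟨Limits.pullback g f', Limits.pullback.fst g f' ≫ f, Limits.pullback.snd g f' ≫ g',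
    inferInstance, inferInstance, ?_, w, fun i => ?_, fun i => ?_⟩
  · rw [Category.assoc, e, Limits.pullback.condition_assoc, e', Category.assoc]
  · simp [hw, hx]
  · simp [hw', hy']

/-- Points which correspond under an isomorphism of open subschemes can be compared through a
partial isomorphism if nonempty opens are dense. -/
theorem exists_partialIso [Nonempty ι] [PreirreducibleSpace P] [PreirreducibleSpace Q]
    {x : ι → P} {y : ι → Q} (h : Linked sP sQ x y) :
    ∃ ω : P.PartialIso Q, ω.IsOver sP sQ ∧
      ∀ i, ∃ u : ω.source, ω.source.ι u = x i ∧ ω.target.ι (ω.iso.hom u) = y i := by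
  obtain ⟨U, f, g, hf, hg, e, u, hx, hy⟩ := h
  obtain ⟨i₀⟩ := ‹Nonempty ι›
  refine ⟨⟨f.opensRange, f.opensRange.2.dense ⟨_, ⟨u i₀, rfl⟩⟩, g.opensRange,
    g.opensRange.2.dense ⟨_, ⟨u i₀, rfl⟩⟩, f.isoOpensRange.symm ≪≫ g.isoOpensRange⟩, ?_, ?_⟩
  · simp [Scheme.PartialIso.IsOver, ← e]
  · intro i
    refine ⟨f.isoOpensRange.hom (u i), ?_, ?_⟩
    · rw [← Scheme.Hom.comp_apply]
      simp [hx]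
    · simp [← Scheme.Hom.comp_apply, hy]

end Linked

/-! ### Elementary birational maps of affine space. -/

/-- The structure morphism of affine space with coordinates indexed by `σ`. -/
noncomputable def affineStructureMap (σ : Type) :
    Spec (CommRingCat.of (MvPolynomial σ ℂ)) ⟶ Spec (CommRingCat.of ℂ) :=
  Spec.map (CommRingCat.ofHom (algebraMap ℂ (MvPolynomial σ ℂ)))

/-- The point of affine space below the `K`-valued point with coordinates `c`. -/
noncomputable def affinePoint {σ : Type} {K : Type} [Field K] [Algebra ℂ K] (c : σ → K) :
    Spec (CommRingCat.of (MvPolynomial σ ℂ)) :=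
  Spec.map (CommRingCat.ofHom (aeval c : MvPolynomial σ ℂ →ₐ[ℂ] K).toRingHom)
    (IsLocalRing.closedPoint K)

theorem Spec_map_ofHom_apply {A B C : Type} [CommRing A] [CommRing B] [CommRing C]
    (f : A →+* B) (g : B →+* C) (p : Spec (CommRingCat.of C)) :
    Spec.map (CommRingCat.ofHom f) (Spec.map (CommRingCat.ofHom g) p) =
      Spec.map (CommRingCat.ofHom (g.comp f)) p := by
  rw [← Scheme.Hom.comp_apply, ← Spec.map_comp, ← CommRingCat.ofHom_comp]

section AffinePoints

variable {ι σ : Type} {K : ι → Type} [∀ i, Field (K i)] [∀ i, Algebra ℂ (K i)]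

/-- Two families of points of affine space, given by coordinates in fields, are related by an
isomorphism between open subschemes. -/
def CoordLinked (c d : ∀ i, σ → K i) : Prop :=
  Linked (affineStructureMap σ) (affineStructureMap σ) (fun i => affinePoint (c i))
    (fun i => affinePoint (d i))

namespace CoordLinked

@[refl]
theorem refl (c : ∀ i, σ → K i) : CoordLinked c c := Linked.refl _ _

theorem symm {c d : ∀ i, σ → K i} (h : CoordLinked c d) : CoordLinked d c := Linked.symm h

theorem trans {c d e : ∀ i, σ → K i} (h : CoordLinked c d) (h' : CoordLinked d e) :
    CoordLinked c e := Linked.trans h h'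

/-- An automorphism of a localization of the polynomial ring links evaluation points. -/
theorem of_away {A : Type} [CommRing A] [Algebra (MvPolynomial σ ℂ) A] [Algebra ℂ A]
    [IsScalarTower ℂ (MvPolynomial σ ℂ) A] (h : MvPolynomial σ ℂ) [IsLocalization.Away h A]
    (ψ : A ≃ₐ[ℂ] A) (ε : ∀ i, A →ₐ[ℂ] K i) (c d : ∀ i, σ → K i)
    (hc : ∀ i m, ε i (algebraMap (MvPolynomial σ ℂ) A (X m)) = c i m)
    (hd : ∀ i m, ε i (ψ (algebraMap (MvPolynomial σ ℂ) A (X m))) = d i m) :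
    CoordLinked c d := by
  let f : Spec (CommRingCat.of A) ⟶ Spec (CommRingCat.of (MvPolynomial σ ℂ)) :=
    Spec.map (CommRingCat.ofHom (algebraMap _ _))
  have hf : IsOpenImmersion f := IsOpenImmersion.of_isLocalization h
  let e : Spec (CommRingCat.of A) ≅ Spec (CommRingCat.of A) :=
    Scheme.Spec.mapIso ψ.toRingEquiv.toCommRingCatIso.op
  have he : e.hom = Spec.map (CommRingCat.ofHom ψ.toRingEquiv.toRingHom) := rfl
  refine ⟨Spec (CommRingCat.of A), f, e.hom ≫ f, hf, inferInstance, ?_,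
    fun i => Spec.map (CommRingCat.ofHom (ε i).toRingHom) (IsLocalRing.closedPoint (K i)),
    fun i => ?_, fun i => ?_⟩
  · simp only [f, he, affineStructureMap, ← Spec.map_comp, ← CommRingCat.ofHom_comp]
    congr 2
    ext z
    have h1 : algebraMap (MvPolynomial σ ℂ) A (algebraMap ℂ _ z) = algebraMap ℂ A z :=
      (IsScalarTower.algebraMap_apply ℂ (MvPolynomial σ ℂ) A z).symm
    change algebraMap (MvPolynomial σ ℂ) A (algebraMap ℂ _ z) =
      ψ (algebraMap (MvPolynomial σ ℂ) A (algebraMap ℂ _ z))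
    rw [h1, AlgEquiv.commutes]
  · have : ((ε i).comp (IsScalarTower.toAlgHom ℂ (MvPolynomial σ ℂ) A)) = aeval (c i) := by
      ext m; simp [hc]
    simp only [f, affinePoint, ← this]
    exact Spec_map_ofHom_apply _ _ _
  · have : (((ε i).comp ψ.toAlgHom).comp (IsScalarTower.toAlgHom ℂ (MvPolynomial σ ℂ) A)) =
        aeval (d i) := by
      ext m; simp [hd]
    simp only [f, affinePoint, ← this, he, Scheme.Hom.comp_apply]
    rw [Spec_map_ofHom_apply]
    exact Spec_map_ofHom_apply _ _ _

/-- Polynomial automorphisms link evaluation points. -/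
theorem of_algEquiv (φ : MvPolynomial σ ℂ ≃ₐ[ℂ] MvPolynomial σ ℂ) (c : ∀ i, σ → K i) :
    CoordLinked c (fun i m => aeval (c i) (φ (X m))) :=
  have : IsLocalization.Away (1 : MvPolynomial σ ℂ) (MvPolynomial σ ℂ) :=
    IsLocalization.away_of_isUnit_of_bijective _ isUnit_one Function.bijective_id
  of_away (A := MvPolynomial σ ℂ) 1 φ (fun i => aeval (c i)) _ _ (fun i m => by simp)
    fun i m => by simp

variable [DecidableEq σ]

/-- Adding a rational function of the other coordinates to one coordinate. -/
theorem update_add_div (c : ∀ i, σ → K i) (k : σ) (g h : MvPolynomial {m // m ≠ k} ℂ)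
    (hh : ∀ i, aeval (fun m : {m // m ≠ k} => c i m) h ≠ 0) :
    CoordLinked c (fun i => Function.update (c i) k
      (c i k + aeval (fun m : {m // m ≠ k} => c i m) g /
        aeval (fun m : {m // m ≠ k} => c i m) h)) := by
  let h' : MvPolynomial σ ℂ := rename Subtype.val h
  let g' : MvPolynomial σ ℂ := rename Subtype.val g
  let A := Localization.Away h'
  let q : A := IsLocalization.mk' A g' (⟨h', 1, by simp⟩ : Submonoid.powers h')
  let x : σ → A := fun m => algebraMap (MvPolynomial σ ℂ) A (X m)
  let a (s : A) : MvPolynomial σ ℂ →ₐ[ℂ] A := aeval (Function.update x k (x k + s))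
  have ha (s : A) (p : MvPolynomial {m // m ≠ k} ℂ) :
      a s (rename Subtype.val p) = algebraMap (MvPolynomial σ ℂ) A (rename Subtype.val p) := by
    have : (a s).comp (rename Subtype.val) =
        (IsScalarTower.toAlgHom ℂ (MvPolynomial σ ℂ) A).comp
          (rename (Subtype.val : {m // m ≠ k} → σ)) := by
      ext m
      simp [a, x, rename_X, Function.update_of_ne m.2]
    exact congr($this p)
  have hu : IsUnit (algebraMap (MvPolynomial σ ℂ) A h') := IsLocalization.Away.algebraMap_isUnit h'
  have hq : q * algebraMap (MvPolynomial σ ℂ) A h' = algebraMap (MvPolynomial σ ℂ) A g' :=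
    IsLocalization.mk'_spec _ _ _
  let b (s : A) : A →ₐ[ℂ] A := IsLocalization.liftAlgHom (M := Submonoid.powers h') (f := a s) (by
    rintro ⟨_, n, rfl⟩
    simp only [map_pow]
    rw [show a s h' = _ from ha s h]
    exact hu.pow n)
  have hb (s : A) (p : MvPolynomial σ ℂ) : b s (algebraMap (MvPolynomial σ ℂ) A p) = a s p := by
    simp [b]
  -- The fraction `q` involves only coordinates other than `k`, so it is fixed; hence subtracting
  -- `q` inverts adding `q`.
  have hbq (s : A) : b s q = q := by
    have h1 := congr(b s $hq)
    rw [map_mul, hb, hb, ha, ha] at h1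
    exact hu.mul_right_cancel (h1.trans hq.symm)
  have hx : ∀ s m, a s (X m) = if m = k then x k + s else x m := by
    intro s m
    simp only [a, aeval_X, Function.update_apply]
  have hcomp (s t : A) (hs : b s t = t) (hst : s + t = 0) : (b s).comp (b t) = AlgHom.id ℂ A := by
    refine IsLocalization.algHom_ext (Submonoid.powers h') ?_
    ext m
    simp only [AlgHom.coe_comp, Function.comp_apply, AlgHom.id_apply]
    change b s (b t (algebraMap (MvPolynomial σ ℂ) A (X m))) = algebraMap (MvPolynomial σ ℂ) A (X m)
    rw [hb, hx]
    split_ifs with hm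
    · subst hm
      rw [map_add, hs, hb, hx, if_pos rfl, add_assoc, hst, add_zero]
    · rw [hb, hx, if_neg hm]
  let ψ : A ≃ₐ[ℂ] A := AlgEquiv.ofAlgHom (b q) (b (-q))
    (hcomp _ _ (by rw [map_neg, hbq]) (add_neg_cancel q)) (hcomp _ _ (hbq _) (neg_add_cancel q))
  have hev (i) (p : MvPolynomial {m // m ≠ k} ℂ) : aeval (c i) (rename Subtype.val p) =
      aeval (fun m : {m // m ≠ k} => c i m) p := by
    rw [aeval_rename]; rfl
  let ε (i) : A →ₐ[ℂ] K i := IsLocalization.liftAlgHom (M := Submonoid.powers h')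
    (f := aeval (c i)) (by
      rintro ⟨_, n, rfl⟩
      simp only [map_pow]
      exact (IsUnit.mk0 _ (by rw [hev]; exact hh i)).pow n)
  have hε (i) (p : MvPolynomial σ ℂ) : ε i (algebraMap (MvPolynomial σ ℂ) A p) = aeval (c i) p := by
    simp [ε]
  have hεq (i) : ε i q = aeval (fun m : {m // m ≠ k} => c i m) g /
        aeval (fun m : {m // m ≠ k} => c i m) h := by
    have h1 := congr(ε i $hq)
    rw [map_mul, hε, hε, hev, hev] at h1
    rw [eq_div_iff (hh i), h1]
  refine of_away h' ψ ε _ _ (fun i m => by rw [hε, aeval_X]) fun i m => ?_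
  change ε i (b q (algebraMap (MvPolynomial σ ℂ) A (X m))) = _
  rw [hb, hx, Function.update_apply]
  split_ifs with hm
  · simp only [map_add, hεq, x, hε, aeval_X]
  · simp only [x, hε, aeval_X]

end CoordLinked

end AffinePoints

/-! ### Separated and generating families; generic translations. -/

section Separation

variable {ι τ τ' : Type} {K : ι → Type} [∀ i, Field (K i)] [∀ i, Algebra ℂ (K i)]

/-- No point of the family specializes to another one. -/
def SeparatedPoints (c : ∀ i, τ → K i) : Prop :=
  ∀ i j, i ≠ j → ∃ e : MvPolynomial τ ℂ, aeval (c i) e ≠ 0 ∧ aeval (c j) e = 0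

theorem SeparatedPoints.of_comp (φ : τ' → τ) {c : ∀ i, τ → K i}
    (h : SeparatedPoints fun i m => c i (φ m)) : SeparatedPoints c := by
  intro i j hij
  obtain ⟨e, h1, h2⟩ := h i j hij
  refine ⟨rename φ e, ?_, ?_⟩ <;> rw [aeval_rename]
  exacts [h1, h2]

/-- Each tuple of the family generates its field over `ℂ`. -/
def GeneratingTuples (c : ∀ i, τ → K i) : Prop :=
  ∀ i, IntermediateField.adjoin ℂ (Set.range (c i)) = ⊤

theorem GeneratingTuples.of_comp (φ : τ' → τ) {c : ∀ i, τ → K i}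
    (h : GeneratingTuples fun i m => c i (φ m)) : GeneratingTuples c := by
  intro i
  rw [← top_le_iff, ← h i]
  exact IntermediateField.adjoin.mono _ _ _ (Set.range_comp_subset_range φ (c i))

theorem GeneratingTuples.add_algebraMap {c : ∀ i, τ → K i} (h : GeneratingTuples c)
    (μ : ι → τ → ℂ) : GeneratingTuples fun i m => c i m + algebraMap ℂ (K i) (μ i m) := by
  intro i
  rw [← top_le_iff, ← h i, IntermediateField.adjoin_le_iff]
  rintro _ ⟨m, rfl⟩
  rw [← add_sub_cancel_right (c i m) (algebraMap ℂ (K i) (μ i m))]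
  exact sub_mem (IntermediateField.subset_adjoin _ _ ⟨m, rfl⟩)
    (IntermediateField.algebraMap_mem _ _)

/-- A `ℂ`-linear functional that does not kill some coefficient of `P j` turns it into a nonzero
complex polynomial vanishing at every complex zero of `P j`. The product of these polynomials is
nonzero somewhere on `ℂ`-points. -/
theorem MvPolynomial.exists_aeval_algebraMap_ne_zero {J : Type} [Finite J] {L : J → Type}
    [∀ j, Field (L j)] [∀ j, Algebra ℂ (L j)] (P : ∀ j, MvPolynomial τ (L j))
    (hP : ∀ j, P j ≠ 0) :
    ∃ μ : τ → ℂ, ∀ j, eval (fun m => algebraMap ℂ (L j) (μ m)) (P j) ≠ 0 := by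
  have key : ∀ j, ∃ Q : MvPolynomial τ ℂ, Q ≠ 0 ∧ ∀ μ : τ → ℂ,
      eval (fun m => algebraMap ℂ (L j) (μ m)) (P j) = 0 → eval μ Q = 0 := by
    intro j
    obtain ⟨d, hd⟩ := MvPolynomial.ne_zero_iff.mp (hP j)
    obtain ⟨l, hl⟩ : ∃ l : Module.Dual ℂ (L j), l (coeff d (P j)) ≠ 0 := by
      by_contra! H
      exact hd ((Module.forall_dual_apply_eq_zero_iff ℂ _).mp H)
    refine ⟨∑ e ∈ (P j).support, monomial e (l (coeff e (P j))), ?_, fun μ h => ?_⟩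
    · refine MvPolynomial.ne_zero_iff.mpr ⟨d, ?_⟩
      classical
      simp only [coeff_sum, coeff_monomial, Finset.sum_ite_eq']
      rwa [if_pos (mem_support_iff.mpr hd)]
    · have h0 := congr(l $h)
      rw [map_zero, eval_eq, map_sum] at h0
      rw [map_sum, ← h0]
      refine Finset.sum_congr rfl fun e _ => ?_
      rw [eval_monomial, Finsupp.prod]
      simp only [← map_pow, ← map_prod]
      rw [mul_comm (coeff e (P j)), ← Algebra.smul_def, map_smul, smul_eq_mul, mul_comm]
  choose Q hQ hQ' using key
  cases nonempty_fintype J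
  have hprod : ∏ j, Q j ≠ 0 := Finset.prod_ne_zero_iff.mpr fun j _ => hQ j
  obtain ⟨μ, hμ⟩ : ∃ μ : τ → ℂ, eval μ (∏ j, Q j) ≠ 0 := by
    by_contra! H
    exact hprod (MvPolynomial.funext fun μ => by rw [H, map_zero])
  rw [map_prod, Finset.prod_ne_zero_iff] at hμ
  exact ⟨μ, fun j h => hμ j (Finset.mem_univ j) (hQ' j μ h)⟩

/-- Generic translations separate points lying on hypersurfaces. -/
theorem exists_translate_separatedPoints [Finite ι] {T : Type} [Finite T]
    (u : T → ∀ i, τ → K i) (G : T → ι → MvPolynomial τ ℂ) (hG : ∀ t i, G t i ≠ 0)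
    (hu : ∀ t i, aeval (u t i) (G t i) = 0) (N : ι → ℂ) (hN : N.Injective) :
    ∃ μ : τ → ℂ, ∀ t, SeparatedPoints fun i m => u t i m + algebraMap ℂ (K i) (N i * μ m) := by
  let J := T × {p : ι × ι // p.1 ≠ p.2}
  -- For a pair `(i, j)`, this is the translated equation of point `j` evaluated at the translated
  -- point `i`, as a polynomial in the unknown translation `μ`.
  let P (j : J) : MvPolynomial τ (K j.2.1.1) :=
    aeval (fun m => C (u j.1 j.2.1.1 m) +
      C (algebraMap ℂ _ (N j.2.1.1 - N j.2.1.2)) * X m) (G j.1 j.2.1.2)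
  have hP : ∀ j, P j ≠ 0 := by
    rintro ⟨t, ⟨i, j⟩, hij⟩ h0
    simp only [P] at h0
    have hδ : algebraMap ℂ (K i) (N i - N j) ≠ 0 := by
      rw [map_ne_zero_iff _ (algebraMap ℂ (K i)).injective, sub_ne_zero]
      exact hN.ne hij
    have h1 : map (algebraMap ℂ (K i)) (G t j) = 0 := by
      -- Since `N i ≠ N j`, the substitution defining `P` is an invertible affine change of
      -- variables; `β` undoes it.
      let β : MvPolynomial τ (K i) →ₐ[K i] MvPolynomial τ (K i) :=
        aeval fun m => C (algebraMap ℂ (K i) (N i - N j))⁻¹ * (X m - C (u t i m))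
      have h2 := congr(β $h0)
      rw [map_zero] at h2
      rw [← h2]
      have : ((β.restrictScalars ℂ).comp (aeval fun m => C (u t i m) +
          C (algebraMap ℂ (K i) (N i - N j)) * X m)) = mapAlgHom (Algebra.ofId ℂ (K i)) := by
        ext m
        simp only [AlgHom.coe_comp, Function.comp_apply, aeval_X, AlgHom.coe_restrictScalars',
          map_add, map_mul, algHom_C, β, mapAlgHom_apply, algebraMap_eq]
        rw [← mul_assoc, ← map_mul, mul_inv_cancel₀ hδ]
        simp
      exact congr($this.symm (G t j))
    exact hG t j (map_injective _ (algebraMap ℂ (K i)).injective (by rw [h1, map_zero]))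
  obtain ⟨μ, hμ⟩ := MvPolynomial.exists_aeval_algebraMap_ne_zero P hP
  refine ⟨μ, fun t i j hij => ⟨aeval (fun m => X m - C (N j * μ m)) (G t j), ?_, ?_⟩⟩
  · have h1 := hμ ⟨t, ⟨i, j⟩, hij⟩
    convert h1 using 1
    rw [← AlgHom.comp_apply, comp_aeval]
    change _ = (eval (fun m => algebraMap ℂ (K i) (μ m))) (P ⟨t, ⟨i, j⟩, hij⟩)
    have : ((aeval (fun m => algebraMap ℂ (K i) (μ m)) :
        MvPolynomial τ (K i) →ₐ[K i] K i).restrictScalars ℂ).comp (aeval fun m => C (u t i m) +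
          C (algebraMap ℂ (K i) (N i - N j)) * X m) = aeval (fun m =>
          aeval (fun m => u t i m + algebraMap ℂ (K i) (N i * μ m))
            (X m - C (N j * μ m) : MvPolynomial τ ℂ)) := by
      ext m
      simp
      ring
    rw [← this]
    simp only [P, AlgHom.comp_apply, AlgHom.restrictScalars_apply]
    rfl
  · rw [← AlgHom.comp_apply, comp_aeval]
    convert hu t j using 3
    ext m
    simp

end Separation

/-! ### Changing one coordinate at a time. -/

namespace CoordLinked

variable {ι σ : Type} {K : ι → Type} [∀ i, Field (K i)] [∀ i, Algebra ℂ (K i)]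
  [Finite ι] [DecidableEq σ]

/-- Changing one coordinate by elements of the fields generated by the other coordinates. -/
theorem update_of_separatedPoints (c : ∀ i, σ → K i) (k : σ)
    (hc : SeparatedPoints fun i (m : {m // m ≠ k}) => c i m) (v : ∀ i, K i)
    (hv : ∀ i, v i - c i k ∈
      IntermediateField.adjoin ℂ (Set.range fun m : {m // m ≠ k} => c i m)) :
    CoordLinked c (fun i => Function.update (c i) k (v i)) := by
  have key : ∀ i, ∃ g h : MvPolynomial {m // m ≠ k} ℂ,
      aeval (fun m : {m // m ≠ k} => c i m) h ≠ 0 ∧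
      v i - c i k = aeval (fun m : {m // m ≠ k} => c i m) g /
        aeval (fun m : {m // m ≠ k} => c i m) h := by
    intro i
    obtain ⟨g, h, e⟩ := (IntermediateField.mem_adjoin_range_iff ℂ _ _).mp (hv i)
    -- A vanishing denominator gives the value `0` by convention; it is rewritten as `0 / 1`.
    by_cases h0 : aeval (fun m : {m // m ≠ k} => c i m) h = 0
    · exact ⟨0, 1, by simp, by simp [e, h0]⟩
    · exact ⟨g, h, h0, e⟩
  choose g h hh hgh using key
  choose! e he he' using hc
  classical
  cases nonempty_fintype ι
  -- `F i` is nonzero at point `i` and zero at the other points, so `(∑ F j * g j) / (∑ F j * h j)`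
  -- takes the value `g i / h i` at point `i`.
  let F (i : ι) : MvPolynomial {m // m ≠ k} ℂ := ∏ j ∈ Finset.univ.erase i, e i j
  have hF (i) : aeval (fun m : {m // m ≠ k} => c i m) (F i) ≠ 0 := by
    rw [map_prod, Finset.prod_ne_zero_iff]
    intro j hj
    exact he i j (Finset.ne_of_mem_erase hj).symm
  have hF' (i j) (hij : j ≠ i) : aeval (fun m : {m // m ≠ k} => c i m) (F j) = 0 := by
    rw [map_prod]
    exact Finset.prod_eq_zero (Finset.mem_erase.mpr ⟨hij.symm, Finset.mem_univ i⟩) (he' j i hij)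
  have hsum (p : ι → MvPolynomial {m // m ≠ k} ℂ) (i) :
      aeval (fun m : {m // m ≠ k} => c i m) (∑ j, F j * p j) =
      aeval (fun m : {m // m ≠ k} => c i m) (F i) *
        aeval (fun m : {m // m ≠ k} => c i m) (p i) := by
    rw [map_sum, Finset.sum_eq_single i, map_mul]
    · intro j _ hj
      rw [map_mul, hF' i j hj, zero_mul]
    · simp
  have := update_add_div c k (∑ j, F j * g j) (∑ j, F j * h j) fun i => by
    rw [hsum]
    exact mul_ne_zero (hF i) (hh i)
  convert this using 3 with i
  rw [hsum, hsum, mul_div_mul_left _ _ (hF i), ← hgh, add_sub_cancel]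

theorem update_of_generatingTuples (c : ∀ i, σ → K i) (k : σ)
    (hc : SeparatedPoints fun i (m : {m // m ≠ k}) => c i m)
    (hg : GeneratingTuples fun i (m : {m // m ≠ k}) => c i m) (v : ∀ i, K i) :
    CoordLinked c (fun i => Function.update (c i) k (v i)) :=
  update_of_separatedPoints c k hc v fun i => by rw [hg i]; trivial

/-- Changing the coordinate `k` with the help of the auxiliary coordinate `o`. -/
theorem update_of_auxiliary (c : ∀ i, σ → K i) (o k : σ) (hk : k ≠ o) (v : ∀ i, K i)
    (hc : SeparatedPoints fun i (m : {m // m ≠ o}) => c i m)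
    (hg : GeneratingTuples fun i (m : {m // m ≠ o}) => c i m)
    (hc' : SeparatedPoints fun i (m : {m // m ≠ o}) => Function.update (c i) k (v i) m)
    (hg' : GeneratingTuples fun i (m : {m // m ≠ o}) => Function.update (c i) k (v i) m) :
    CoordLinked c (fun i => Function.update (c i) k (v i)) := by
  -- Three moves: store `v` in `o`, copy it to `k`, and restore `o`. For the second move, the
  -- coordinates other than `k` are, up to the renaming `φ`, those of the target tuple other than
  -- `o`.
  have h1 := update_of_generatingTuples c o hc hg v
  refine h1.trans ?_
  obtain ⟨φ, hφ⟩ : ∃ φ : {m // m ≠ o} → {m // m ≠ k},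
      (fun i (m : {m // m ≠ o}) => Function.update (c i) o (v i) (φ m)) =
      fun i (m : {m // m ≠ o}) => Function.update (c i) k (v i) m := by
    refine ⟨fun m => if h : m.1 = k then ⟨o, hk.symm⟩ else ⟨m, h⟩, ?_⟩
    funext i m
    by_cases h : m.1 = k
    · simp [h]
    · simp [h, m.2]
  obtain ⟨d, hd⟩ : ∃ d : ∀ i, σ → K i, d = fun i => Function.update (c i) o (v i) := ⟨_, rfl⟩
  rw [← hd]
  replace hφ : (fun i (m : {m // m ≠ o}) => d i (φ m)) =
      fun i (m : {m // m ≠ o}) => Function.update (c i) k (v i) m := by rw [hd]; exact hφ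
  have h2 := update_of_generatingTuples d k (SeparatedPoints.of_comp φ (by rw [hφ]; exact hc'))
    (GeneratingTuples.of_comp φ (by rw [hφ]; exact hg')) v
  refine h2.trans ?_
  obtain ⟨e, he⟩ : ∃ e : ∀ i, σ → K i, e = fun i => Function.update (d i) k (v i) := ⟨_, rfl⟩
  rw [← he]
  have hψ : (fun i (m : {m // m ≠ o}) => e i m) =
      fun i (m : {m // m ≠ o}) => Function.update (c i) k (v i) m := by
    funext i m
    simp only [he, hd]
    rw [Function.update_comm hk.symm, Function.update_of_ne m.2]
  have h3 := update_of_generatingTuples e o (by rw [hψ]; exact hc') (by rw [hψ]; exact hg')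
    (fun i => c i o)
  have h4 : (fun i => Function.update (e i) o (c i o)) =
      fun i => Function.update (c i) k (v i) := by
    funext i
    simp only [he, hd]
    rw [Function.update_comm hk, Function.update_idem, Function.update_eq_self]
  rw [← h4]
  exact h3

/-- If the coordinate `o` takes distinct constant values then the other coordinates of the points
can be translated independently. -/
theorem translate [Finite σ] (c : ∀ i, σ → K i) (o : σ) (N : ι → ℂ) (hN : N.Injective)
    (hc : ∀ i, c i o = algebraMap ℂ (K i) (N i)) (μ : ι → σ → ℂ) (hμ : ∀ i, μ i o = 0) :
    CoordLinked c fun i m => c i m + algebraMap ℂ (K i) (μ i m) := by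
  cases nonempty_fintype σ
  suffices H : ∀ s : Finset σ, o ∉ s →
      CoordLinked c fun i m => if m ∈ s then c i m + algebraMap ℂ (K i) (μ i m) else c i m by
    convert H (Finset.univ.erase o) (by simp) using 3 with i m
    by_cases h : m = o
    · simp [h, hμ]
    · simp [h]
  intro s
  induction s using Finset.induction_on with
  | empty => intro _; simpa using refl c
  | insert k s hks ih =>
    intro ho
    have ho' : o ∉ s := fun h => ho (Finset.mem_insert_of_mem h)
    have hk : o ≠ k := fun h => ho (h ▸ Finset.mem_insert_self _ _)
    refine (ih ho').trans ?_
    -- The distinct constants at `o` separate the points, and the increment is a constant, so it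
    -- lies in every subfield over `ℂ`.
    have := update_of_separatedPoints
      (fun i m => if m ∈ s then c i m + algebraMap ℂ (K i) (μ i m) else c i m) k
      (fun i j hij => ⟨X ⟨o, hk⟩ - C (N j), by
          simpa [ho', hc, sub_eq_zero] using hN.ne hij, by simp [ho', hc]⟩)
      (fun i => c i k + algebraMap ℂ (K i) (μ i k)) (fun i => by
        simpa [hks] using IntermediateField.algebraMap_mem _ _)
    convert this using 2 with i
    ext m
    by_cases h : m = k
    · subst h; simp
    · simp [h]

/-- If the coordinate `o` takes distinct constant values then another coordinate can be changed,
provided that the coordinates different from `o` are generating before and after the change, and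
satisfy a nontrivial algebraic relation. -/
theorem update_of_dependent [Finite σ] (c : ∀ i, σ → K i) (o k : σ) (hk : k ≠ o) (N : ι → ℂ)
    (hN : N.Injective) (hc : ∀ i, c i o = algebraMap ℂ (K i) (N i)) (v : ∀ i, K i)
    (hg : GeneratingTuples fun i (m : {m // m ≠ o}) => c i m)
    (hg' : GeneratingTuples fun i (m : {m // m ≠ o}) => Function.update (c i) k (v i) m)
    (hd : ∀ i, ¬ AlgebraicIndependent ℂ fun m : {m // m ≠ o} => c i m)
    (hd' : ∀ i, ¬ AlgebraicIndependent ℂ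
      fun m : {m // m ≠ o} => Function.update (c i) k (v i) m) :
    CoordLinked c (fun i => Function.update (c i) k (v i)) := by
  -- The index `true` stands for the tuples before the change and `false` for those after it; a
  -- single translation must separate both families.
  let u : Bool → ∀ i, {m // m ≠ o} → K i := fun t i m =>
    if t then c i m else Function.update (c i) k (v i) m
  have hu : ∀ t i, ∃ G : MvPolynomial {m // m ≠ o} ℂ, G ≠ 0 ∧ aeval (u t i) G = 0 := by
    intro t i
    have h : ¬ AlgebraicIndependent ℂ (u t i) := by
      cases t
      · simpa [u] using hd' i
      · simpa [u] using hd i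
    rw [algebraicIndependent_iff] at h
    push Not at h
    obtain ⟨G, h1, h2⟩ := h
    exact ⟨G, h2, h1⟩
  choose G hG hG' using hu
  obtain ⟨μ, hμ⟩ := exists_translate_separatedPoints u G hG hG' N hN
  let M : ι → σ → ℂ := fun i m => if h : m ≠ o then N i * μ ⟨m, h⟩ else 0
  have hM (i) : M i o = 0 := by simp [M]
  have hM' (i) (m : {m // m ≠ o}) : M i m = N i * μ m := by simp [M, m.2]
  have hc' (i) : Function.update (c i) k (v i) o = algebraMap ℂ (K i) (N i) := by
    rw [Function.update_of_ne hk.symm, hc]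
  -- The move is conjugated by the translation, so that it takes place in separated position.
  refine (translate c o N hN hc M hM).trans (CoordLinked.trans ?_
    (translate _ o N hN hc' M hM).symm)
  have hup (i) : Function.update (fun m => c i m + algebraMap ℂ (K i) (M i m)) k
      (v i + algebraMap ℂ (K i) (M i k)) =
      fun m => Function.update (c i) k (v i) m + algebraMap ℂ (K i) (M i m) := by
    ext m
    by_cases h : m = k
    · subst h; simp
    · simp [h]
  have := update_of_auxiliary (fun i m => c i m + algebraMap ℂ (K i) (M i m)) o k hk
    (fun i => v i + algebraMap ℂ (K i) (M i k))
    (by simpa only [hM', u, if_true] using hμ true)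
    (hg.add_algebraMap fun i m => M i m)
    (by simpa only [hup, hM', u, if_false, Bool.false_eq_true] using hμ false)
    (by simpa only [hup] using hg'.add_algebraMap fun i m => M i m)
  simpa only [hup] using this

end CoordLinked

/-! ### Generic elements of finitely generated fields. -/

section FieldGeneration

variable {L : Type} [Field L] [Algebra ℂ L]

open AlgebraicIndependent in
-- `L` is finitely generated and algebraic over the field generated by `A`, hence finite over it. In
-- characteristic zero the primitive element theorem then bounds the intermediate fields.
theorem finite_intermediateField_of_spanning [Algebra.EssFiniteType ℂ L] (A : Set L)
    (hA : (matroid ℂ L).Spanning A) :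
    Finite (IntermediateField (IntermediateField.adjoin ℂ A) L) := by
  let F := IntermediateField.adjoin ℂ A
  have h1 : Algebra.IsAlgebraic (Algebra.adjoin ℂ A) L := matroid_spanning_iff.mp hA
  have hle : Algebra.adjoin ℂ A ≤ F.toSubalgebra := IntermediateField.algebra_adjoin_le_adjoin ℂ A
  have h2 : Algebra.IsAlgebraic F L := by
    letI : Algebra (Algebra.adjoin ℂ A) F := (Subalgebra.inclusion hle).toAlgebra
    haveI : IsScalarTower (Algebra.adjoin ℂ A) F L := IsScalarTower.of_algebraMap_eq fun _ => rfl
    exact Algebra.IsAlgebraic.extendScalars (R := Algebra.adjoin ℂ A)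
      (Subalgebra.inclusion_injective hle)
  have h3 : Algebra.EssFiniteType F L := Algebra.EssFiniteType.of_comp ℂ F L
  have h4 : FiniteDimensional F L := Algebra.finite_of_essFiniteType_of_isAlgebraic
  exact Field.finite_intermediateField_of_exists_primitive_element F L
    (Field.exists_primitive_element F L)

theorem IntermediateField.adjoin_insert_eq_top {A : Set L} {x : L}
    (h : IntermediateField.adjoin (IntermediateField.adjoin ℂ A) {x} = ⊤) :
    IntermediateField.adjoin ℂ (insert x A) = ⊤ := by
  have h7 := IntermediateField.adjoin_adjoin_left ℂ A {x}
  rw [Set.union_comm, Set.singleton_union] at h7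
  rw [← h7, h]
  rfl

open AlgebraicIndependent in
/-- A primitive element over the field generated by `A` exists outside of finitely many
proper subspaces. -/
theorem exists_subspaces_primitive [Algebra.EssFiniteType ℂ L] (A : Set L)
    (hA : (matroid ℂ L).Spanning A) :
    ∃ s : Finset (Subspace ℂ L), ⊤ ∉ s ∧ ∀ x, (∀ p ∈ s, x ∉ p) →
      IntermediateField.adjoin ℂ (insert x A) = ⊤ := by
  classical
  let F := IntermediateField.adjoin ℂ A
  have h5 : Finite (IntermediateField F L) := finite_intermediateField_of_spanning A hA
  cases nonempty_fintype (IntermediateField F L)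
  let f (E : IntermediateField F L) : Subspace ℂ L :=
    Subalgebra.toSubmodule (E.restrictScalars ℂ).toSubalgebra
  refine ⟨(Finset.univ.erase ⊤).image f, ?_, fun x hx => ?_⟩
  · intro h
    obtain ⟨E, hE, h⟩ := Finset.mem_image.mp h
    refine (Finset.ne_of_mem_erase hE) (eq_top_iff.mpr fun x _ => ?_)
    have : x ∈ f E := h ▸ Submodule.mem_top
    exact this
  · have h6 : IntermediateField.adjoin F {x} = ⊤ := by
      by_contra h
      exact hx _ (Finset.mem_image_of_mem f (Finset.mem_erase.mpr ⟨h, Finset.mem_univ _⟩))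
        (IntermediateField.mem_adjoin_simple_self F x)
    exact IntermediateField.adjoin_insert_eq_top h6

open AlgebraicIndependent in
/-- Exchange property for algebraically spanning sets, outside of finitely many subspaces. -/
theorem exists_subspaces_spanning (A : Set L) (y : L)
    (hA : (matroid ℂ L).Spanning (insert y A)) :
    ∃ s : Finset (Subspace ℂ L), ⊤ ∉ s ∧ ∀ x, (∀ p ∈ s, x ∉ p) →
      (matroid ℂ L).Spanning (insert x A) := by
  let M := matroid ℂ L
  have hE : M.E = Set.univ := matroid_e _ _
  have hcl : ((Subalgebra.algebraicClosure (Algebra.adjoin ℂ A) L).restrictScalars ℂ : Set L) =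
    M.closure A := matroid_closure_eq.symm
  by_cases h : M.closure A = Set.univ
  · refine ⟨∅, by simp, fun x _ => ?_⟩
    have : M.Spanning A := by
      rw [Matroid.spanning_iff, h, hE]
      exact ⟨rfl, Set.subset_univ _⟩
    exact this.superset (Set.subset_insert _ _) (by rw [hE]; exact Set.subset_univ _)
  -- The elements algebraic over `A` form a proper subspace; any `x` outside it can be exchanged for
  -- `y`.
  · refine ⟨{Subalgebra.toSubmodule
      ((Subalgebra.algebraicClosure (Algebra.adjoin ℂ A) L).restrictScalars ℂ)}, ?_,
      fun x hx => ?_⟩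
    · rw [Finset.mem_singleton]
      intro h'
      refine h (Set.eq_univ_of_forall fun z => ?_)
      rw [← hcl]
      have : z ∈ (⊤ : Subspace ℂ L) := trivial
      rw [h'] at this
      exact this
    · have hx' : x ∉ M.closure A := by
        rw [← hcl]
        exact hx _ (Finset.mem_singleton_self _)
      have hsub : ∀ B : Set L, B ⊆ M.E := fun B => by rw [hE]; exact Set.subset_univ _
      have hy : y ∈ M.closure (insert x A) :=
        Matroid.mem_closure_insert hx' (by rw [hA.closure_eq, hE]; trivial)
      rw [Matroid.spanning_iff_ground_subset_closure (hsub _), ← hA.closure_eq]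
      exact M.closure_subset_closure_of_subset_closure (Set.insert_subset hy
        ((Set.subset_insert _ _).trans (M.subset_closure _ (hsub _))))

open AlgebraicIndependent in
/-- Replacing a redundant element of finitely many algebraically spanning tuples simultaneously
by a common primitive element, in such a way that any other element becomes redundant. -/
theorem exists_common_exchange [Algebra.EssFiniteType ℂ L] {τ T : Type} [Finite τ] [Finite T]
    [DecidableEq τ] (c : T → τ → L) (k : τ) (hc : ∀ t, (matroid ℂ L).Spanning (c t '' {k}ᶜ)) :
    ∃ x : L, ∀ t, IntermediateField.adjoin ℂ (Set.range (Function.update (c t) k x)) = ⊤ ∧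
      ∀ l, l ≠ k → (matroid ℂ L).Spanning (Function.update (c t) k x '' {l}ᶜ) := by
  classical
  have h1 (t) := exists_subspaces_primitive _ (hc t)
  have h2 : ∀ (t) (l : {l // l ≠ k}), ∃ s : Finset (Subspace ℂ L), ⊤ ∉ s ∧
      ∀ x, (∀ p ∈ s, x ∉ p) → (matroid ℂ L).Spanning (insert x (c t '' {k, l.1}ᶜ)) := by
    intro t l
    refine exists_subspaces_spanning _ (c t l) ?_
    rw [← Set.image_insert_eq]
    convert hc t using 2
    ext m
    simp only [Set.mem_insert_iff, Set.mem_compl_iff, Set.mem_singleton_iff, not_or]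
    by_cases h : m = l
    · simp [h, l.2]
    · simp [h]
  choose s1 hs1 hs1' using h1
  choose s2 hs2 hs2' using h2
  cases nonempty_fintype τ
  cases nonempty_fintype T
  let s := (Finset.univ.biUnion s1) ∪ Finset.univ.biUnion fun t => Finset.univ.biUnion (s2 t)
  have hs : ⊤ ∉ s := by
    simp only [s, Finset.mem_union, Finset.mem_biUnion, Finset.mem_univ, true_and]
    rintro (⟨t, h⟩ | ⟨t, l, h⟩)
    exacts [hs1 t h, hs2 t l h]
  -- A vector space over an infinite field is not a finite union of proper subspaces.
  obtain ⟨x, hx⟩ := (Set.ne_univ_iff_exists_notMem _).mp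
    (Subspace.biUnion_ne_univ_of_top_notMem hs)
  simp only [Set.mem_iUnion, not_exists, SetLike.mem_coe] at hx
  refine ⟨x, fun t => ⟨?_, fun l hl => ?_⟩⟩
  · have := hs1' t x fun p hp => hx p (by
      simp only [s, Finset.mem_union, Finset.mem_biUnion, Finset.mem_univ, true_and]
      exact Or.inl ⟨t, hp⟩)
    convert this using 2
    ext y
    constructor
    · rintro ⟨m, rfl⟩
      by_cases h : m = k
      · subst h; simp
      · rw [Function.update_of_ne h]
        exact Set.mem_insert_of_mem _ ⟨m, h, rfl⟩
    · rintro (rfl | ⟨m, hm, rfl⟩)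
      · exact ⟨k, by simp⟩
      · exact ⟨m, Function.update_of_ne hm _ _⟩
  · have := hs2' t ⟨l, hl⟩ x fun p hp => hx p (by
      simp only [s, Finset.mem_union, Finset.mem_biUnion, Finset.mem_univ, true_and]
      exact Or.inr ⟨t, _, hp⟩)
    convert this using 1
    ext y
    constructor
    · rintro ⟨m, hm, rfl⟩
      by_cases h : m = k
      · subst h; simp
      · rw [Function.update_of_ne h]
        exact Set.mem_insert_of_mem _ ⟨m, by simpa [h] using hm, rfl⟩
    · rintro (rfl | ⟨m, hm, rfl⟩)
      · exact ⟨k, by simpa using hl.symm, by simp⟩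
      · simp only [Set.mem_compl_iff, Set.mem_insert_iff, Set.mem_singleton_iff, not_or] at hm
        exact ⟨m, hm.2, Function.update_of_ne hm.1 _ _⟩

end FieldGeneration

/-! ### Moving two prepared families to common coordinates. -/

namespace CoordLinked

variable {ι σ : Type} {K : ι → Type} [∀ i, Field (K i)] [∀ i, Algebra ℂ (K i)]
  [Finite ι] [DecidableEq σ] [Finite σ]

/-- The coordinate `o` has distinct constant values, the others generate, and the coordinates in `Q`
are redundant up to algebraic extensions. -/
structure Prepared (c : ∀ i, σ → K i) (o : σ) (N : ι → ℂ) (Q : Set {m // m ≠ o}) : Prop where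
  const : ∀ i, c i o = algebraMap ℂ (K i) (N i)
  gen : GeneratingTuples fun i (m : {m // m ≠ o}) => c i m
  redundant : ∀ i, ∀ l ∈ Q, (AlgebraicIndependent.matroid ℂ (K i)).Spanning
    ((fun m : {m // m ≠ o} => c i m) '' {l}ᶜ)

/-- One choice of `v` is generic for both families. It uses up the redundancy of `k` and makes every
other coordinate redundant, which is what the next update needs. -/
theorem Prepared.exists_common_update {c d : ∀ i, σ → K i} {o : σ} {N : ι → ℂ} (hN : N.Injective)
    {Q : Set {m // m ≠ o}} (hc : Prepared c o N Q) (hd : Prepared d o N Q)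
    (htr : ∀ i (t : {m // m ≠ o} → K i), ¬ AlgebraicIndependent ℂ t) (k : {m // m ≠ o})
    (hk : k ∈ Q) :
    ∃ v : ∀ i, K i, CoordLinked c (fun i => Function.update (c i) (k : σ) (v i)) ∧
      CoordLinked d (fun i => Function.update (d i) (k : σ) (v i)) ∧
      Prepared (K := K) (fun i => Function.update (c i) (k : σ) (v i)) o N {k}ᶜ ∧
      Prepared (K := K) (fun i => Function.update (d i) (k : σ) (v i)) o N {k}ᶜ := by
  have key : ∀ i, ∃ x : K i, ∀ t : Bool,
      IntermediateField.adjoin ℂ (Set.range (Function.update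
        (fun m : {m // m ≠ o} => (if t then c else d) i m) k x)) = ⊤ ∧
      ∀ l, l ≠ k → (AlgebraicIndependent.matroid ℂ (K i)).Spanning
        (Function.update (fun m : {m // m ≠ o} => (if t then c else d) i m) k x '' {l}ᶜ) := by
    intro i
    have : Algebra.EssFiniteType ℂ (K i) := by
      rw [← IntermediateField.fg_top_iff, ← hc.gen i]
      exact IntermediateField.fg_adjoin_of_finite (Set.finite_range _)
    refine exists_common_exchange (T := Bool)
      (fun t (m : {m // m ≠ o}) => (if t then c else d) i m) k fun t => ?_
    cases t
    · exact hd.redundant i k hk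
    · exact hc.redundant i k hk
  choose v hv using key
  have hup (c : ∀ i, σ → K i) (i) : (fun m : {m // m ≠ o} => Function.update (c i) (k : σ) (v i) m) =
      Function.update (fun m : {m // m ≠ o} => c i m) k (v i) := by
    ext m
    simp only [Function.update_apply, Subtype.ext_iff]
  have hprep (e : ∀ i, σ → K i) (he : ∀ i, e i o = algebraMap ℂ (K i) (N i))
      (H : ∀ i, IntermediateField.adjoin ℂ (Set.range (Function.update
        (fun m : {m // m ≠ o} => e i m) k (v i))) = ⊤ ∧
      ∀ l, l ≠ k → (AlgebraicIndependent.matroid ℂ (K i)).Spanning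
        (Function.update (fun m : {m // m ≠ o} => e i m) k (v i) '' {l}ᶜ)) :
      Prepared (K := K) (fun i => Function.update (e i) (k : σ) (v i)) o N {k}ᶜ := by
    refine ⟨fun i => ?_, fun i => ?_, fun i l hl => ?_⟩
    · simp only [Function.update_of_ne k.2.symm, he]
    · simp only [hup]
      exact (H i).1
    · simp only [hup]
      exact (H i).2 l hl
  have hlink (e : ∀ i, σ → K i) (he : Prepared e o N Q)
      (he' : Prepared (K := K) (fun i => Function.update (e i) (k : σ) (v i)) o N {k}ᶜ) :
      CoordLinked e (fun i => Function.update (e i) (k : σ) (v i)) :=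
    update_of_dependent e o k k.2 N hN he.const v he.gen he'.gen (fun i => htr i _)
      fun i => htr i _
  have h1 := hprep c hc.const fun i => hv i true
  have h2 := hprep d hd.const fun i => hv i false
  exact ⟨v, hlink c hc h1, hlink d hd h2, h1, h2⟩

/-- Two families with the same distinct constants at the coordinate `o` are linked. -/
theorem of_prepared {c d : ∀ i, σ → K i} {o : σ} {N : ι → ℂ} (hN : N.Injective)
    (k : {m // m ≠ o}) (hc : Prepared c o N {k}) (hd : Prepared d o N {k})
    (htr : ∀ i (t : {m // m ≠ o} → K i), ¬ AlgebraicIndependent ℂ t) : CoordLinked c d := by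
  cases nonempty_fintype σ
  -- Induction on the set of coordinates already made equal; all the others stay redundant. The
  -- known redundant coordinate `k` has to be treated first.
  suffices H : ∀ s : Finset {m // m ≠ o}, ∃ c' d' : ∀ i, σ → K i, CoordLinked c c' ∧
      CoordLinked d d' ∧ (∀ i, ∀ l ∈ insert k s, c' i l = d' i l) ∧
      Prepared c' o N {m | m ∉ insert k s} ∧ Prepared d' o N {m | m ∉ insert k s} by
    obtain ⟨c', d', h1, h2, h3, h4, h5⟩ := H Finset.univ
    have : c' = d' := by
      funext i m
      by_cases h : m = o
      · rw [h, h4.const, h5.const]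
      · exact h3 i ⟨m, h⟩ (by simp)
    exact h1.trans (this ▸ h2.symm)
  intro s
  induction s using Finset.induction_on with
  | empty =>
    obtain ⟨v, h1, h2, h3, h4⟩ := hc.exists_common_update hN hd htr k rfl
    exact ⟨_, _, h1, h2, by simp, ⟨h3.const, h3.gen, fun i l hl => h3.redundant i l (by
      simpa using hl)⟩, ⟨h4.const, h4.gen, fun i l hl => h4.redundant i l (by simpa using hl)⟩⟩
  | insert l s hl ih =>
    obtain ⟨c', d', h1, h2, h3, h4, h5⟩ := ih
    rw [Finset.insert_comm]
    by_cases hlk : l ∈ insert k s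
    · rw [Finset.insert_eq_of_mem hlk]
      exact ⟨c', d', h1, h2, h3, h4, h5⟩
    · obtain ⟨v, h1', h2', h3', h4'⟩ := h4.exists_common_update hN h5 htr l hlk
      have hsub : ({m | m ∉ insert l (insert k s)} : Set {m // m ≠ o}) ⊆ {l}ᶜ := by
        intro m hm hml
        exact hm (Finset.mem_insert.mpr (Or.inl hml))
      refine ⟨_, _, h1.trans h1', h2.trans h2', fun i m hm => ?_,
        ⟨h3'.const, h3'.gen, fun i m hm => h3'.redundant i m (hsub hm)⟩,
        ⟨h4'.const, h4'.gen, fun i m hm => h4'.redundant i m (hsub hm)⟩⟩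
      by_cases hml : m = l
      · subst hml; simp
      · have hml' : (m : σ) ≠ l := fun h => hml (Subtype.ext h)
        simp only [Function.update_of_ne hml']
        exact h3 i m ((Finset.mem_insert.mp hm).resolve_left hml)

end CoordLinked

/-! ### Simultaneous linear Noether normalization. -/

section LinearNormalization

/-- Restricting a polynomial to a line: degree and leading coefficient. -/
theorem MvPolynomial.natDegree_coeff_aeval_line {σ B : Type} [CommRing B] [Algebra ℂ B]
    (G : MvPolynomial σ ℂ) (b : σ → B) (γ : σ → ℂ) :
    (aeval (fun m => Polynomial.C (b m) + Polynomial.C (algebraMap ℂ B (γ m)) * Polynomial.X)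
      G).natDegree ≤ G.totalDegree ∧
    (aeval (fun m => Polynomial.C (b m) + Polynomial.C (algebraMap ℂ B (γ m)) * Polynomial.X)
      G).coeff G.totalDegree =
      algebraMap ℂ B (eval γ (homogeneousComponent G.totalDegree G)) := by
  classical
  let l (m : σ) : Polynomial B :=
    Polynomial.C (b m) + Polynomial.C (algebraMap ℂ B (γ m)) * Polynomial.X
  have hl (m) : (l m).natDegree ≤ 1 := by
    refine (Polynomial.natDegree_add_le _ _).trans (max_le (by simp) ?_)
    exact (Polynomial.natDegree_C_mul_le _ _).trans Polynomial.natDegree_X_le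
  have hlc (m) : (l m).coeff 1 = algebraMap ℂ B (γ m) := by simp [l]
  have hprod (d : σ →₀ ℕ) (s : Finset σ) : (∏ m ∈ s, l m ^ d m).natDegree ≤ ∑ m ∈ s, d m ∧
      (∏ m ∈ s, l m ^ d m).coeff (∑ m ∈ s, d m) = algebraMap ℂ B (∏ m ∈ s, γ m ^ d m) := by
    induction s using Finset.induction_on with
    | empty => simp
    | insert k s hk ih =>
      have h1 : (l k ^ d k).natDegree ≤ d k := by
        simpa using Polynomial.natDegree_pow_le_of_le (d k) (hl k)
      have h2 : (l k ^ d k).coeff (d k) = algebraMap ℂ B (γ k) ^ d k := by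
        have := Polynomial.coeff_pow_of_natDegree_le (m := d k) (hl k)
        rwa [mul_one, hlc] at this
      rw [Finset.prod_insert hk, Finset.sum_insert hk, Finset.prod_insert hk]
      refine ⟨Polynomial.natDegree_mul_le_of_le h1 ih.1, ?_⟩
      rw [Polynomial.coeff_mul_add_eq_of_natDegree_le h1 ih.1, h2, ih.2, map_mul, map_pow]
  have hG : aeval l G = ∑ d ∈ G.support, algebraMap ℂ (Polynomial B) (coeff d G) *
      ∏ m ∈ d.support, l m ^ d m := by
    rw [aeval_def, eval₂_eq]
  have hterm (d) (hd : d ∈ G.support) :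
      (algebraMap ℂ (Polynomial B) (coeff d G) * ∏ m ∈ d.support, l m ^ d m).natDegree ≤
        d.degree := by
    rw [Polynomial.algebraMap_apply]
    exact (Polynomial.natDegree_C_mul_le _ _).trans (hprod d d.support).1
  have hdeg (d) (hd : d ∈ G.support) : d.degree ≤ G.totalDegree := le_totalDegree hd
  change (aeval l G).natDegree ≤ _ ∧ (aeval l G).coeff _ = _
  rw [hG]
  refine ⟨Polynomial.natDegree_sum_le_of_forall_le _ _ fun d hd =>
    (hterm d hd).trans (hdeg d hd), ?_⟩
  rw [Polynomial.finsetSum_coeff, homogeneousComponent_apply, map_sum, map_sum,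
    Finset.sum_filter]
  refine Finset.sum_congr rfl fun d hd => ?_
  split_ifs with h
  · rw [← h, Polynomial.algebraMap_apply, Polynomial.coeff_C_mul, eval_monomial, map_mul]
    congr 1
    exact (hprod d d.support).2
  · exact Polynomial.coeff_eq_zero_of_natDegree_lt
      ((hterm d hd).trans_lt ((hdeg d hd).lt_of_ne h))

theorem MvPolynomial.homogeneousComponent_totalDegree_ne_zero {σ : Type} {G : MvPolynomial σ ℂ}
    (hG : G ≠ 0) : homogeneousComponent G.totalDegree G ≠ 0 := by
  obtain ⟨d, hd, h⟩ := Finset.exists_mem_eq_sup G.support (support_nonempty.mpr hG)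
    (fun d => d.degree)
  refine MvPolynomial.ne_zero_iff.mpr ⟨d, ?_⟩
  rw [coeff_homogeneousComponent, if_pos]
  · exact mem_support_iff.mp hd
  · exact h.symm

variable {ι σ : Type} {K : ι → Type} [∀ i, Field (K i)] [∀ i, Algebra ℂ (K i)] [Finite ι]

/-- Simultaneous Noether normalization of one variable by a linear change of coordinates. -/
theorem exists_linear_isIntegral (t : ∀ i, σ → K i) (o : σ)
    (ht : ∀ i, ¬ AlgebraicIndependent ℂ (t i)) :
    ∃ δ : σ → ℂ, δ o = 0 ∧ ∀ i, IsIntegral (Algebra.adjoin ℂ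
      (Set.range fun m : {m // m ≠ o} => t i m + algebraMap ℂ (K i) (δ m) * t i o)) (t i o) := by
  simp only [algebraicIndependent_iff] at ht
  push Not at ht
  choose G hG' hG using ht
  cases nonempty_fintype ι
  -- A direction with `γ o ≠ 0` in which no leading form vanishes.
  obtain ⟨γ, hγ⟩ : ∃ γ : σ → ℂ,
      eval γ (X o * ∏ i, homogeneousComponent (G i).totalDegree (G i)) ≠ 0 := by
    by_contra! H
    refine mul_ne_zero (X_ne_zero o) (Finset.prod_ne_zero_iff.mpr fun i _ =>
      MvPolynomial.homogeneousComponent_totalDegree_ne_zero (hG i))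
      (MvPolynomial.funext fun γ => by rw [H, map_zero])
  rw [map_mul, eval_X, map_prod] at hγ
  have hγo : γ o ≠ 0 := left_ne_zero_of_mul hγ
  have hγG (i) : eval γ (homogeneousComponent (G i).totalDegree (G i)) ≠ 0 :=
    Finset.prod_ne_zero_iff.mp (right_ne_zero_of_mul hγ) i (Finset.mem_univ i)
  classical
  refine ⟨fun m => if m = o then 0 else - γ m / γ o, if_pos rfl, fun i => ?_⟩
  set B := Algebra.adjoin ℂ (Set.range fun m : {m // m ≠ o} =>
    t i m + algebraMap ℂ (K i) (if m = o then 0 else - γ m / γ o) * t i o) with hB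
  -- Each tuple lies on a line in direction `γ` through a point with coordinates in `B`. Restricted
  -- to this line, `G i` has a nonzero constant as leading coefficient, which makes the parameter `t
  -- i o / γ o` integral over `B`.
  have hb : ∀ m, ∃ b : B, t i m = b + algebraMap ℂ (K i) (γ m) *
      (algebraMap ℂ (K i) (γ o)⁻¹ * t i o) := by
    intro m
    have hne : algebraMap ℂ (K i) (γ o) ≠ 0 := by
      rwa [map_ne_zero_iff _ (algebraMap ℂ (K i)).injective]
    by_cases h : m = o
    · subst h
      exact ⟨0, by rw [ZeroMemClass.coe_zero, zero_add, map_inv₀, mul_inv_cancel_left₀ hne]⟩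
    · refine ⟨⟨_, Algebra.subset_adjoin ⟨⟨m, h⟩, rfl⟩⟩, ?_⟩
      simp only [if_neg h, map_div₀, map_neg, map_inv₀]
      field_simp
      ring
  choose b hb using hb
  have hx : IsIntegral B (algebraMap ℂ (K i) (γ o)⁻¹ * t i o) := by
    obtain ⟨h1, h2⟩ := MvPolynomial.natDegree_coeff_aeval_line (G i) b γ
    set P := aeval (fun m => Polynomial.C (b m) +
      Polynomial.C (algebraMap ℂ B (γ m)) * Polynomial.X) (G i)
    refine ⟨Polynomial.C (algebraMap ℂ B
      (eval γ (homogeneousComponent (G i).totalDegree (G i)))⁻¹) * P, ?_, ?_⟩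
    · refine Polynomial.monic_of_natDegree_le_of_coeff_eq_one (G i).totalDegree
        ((Polynomial.natDegree_C_mul_le _ _).trans h1) ?_
      rw [Polynomial.coeff_C_mul, h2, ← map_mul, inv_mul_cancel₀ (hγG i), map_one]
    · rw [← Polynomial.aeval_def, map_mul]
      have : ((Polynomial.aeval (algebraMap ℂ (K i) (γ o)⁻¹ * t i o) :
          Polynomial B →ₐ[B] K i).restrictScalars ℂ).comp (aeval (fun m => Polynomial.C (b m) +
          Polynomial.C (algebraMap ℂ B (γ m)) * Polynomial.X)) = aeval (t i) := by
        ext m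
        simp only [AlgHom.coe_comp, Function.comp_apply, aeval_X, AlgHom.coe_restrictScalars',
          map_add, map_mul, Polynomial.aeval_C, Polynomial.aeval_X]
        rw [hb m]
        rfl
      have h3 : Polynomial.aeval (algebraMap ℂ (K i) (γ o)⁻¹ * t i o) P = 0 := by
        rw [← hG' i, ← this]
        rfl
      rw [h3, mul_zero]
  have h4 : t i o = algebraMap B (K i) (algebraMap ℂ B (γ o)) *
      (algebraMap ℂ (K i) (γ o)⁻¹ * t i o) := by
    rw [← IsScalarTower.algebraMap_apply, ← mul_assoc, ← map_mul, mul_inv_cancel₀ hγo, map_one,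
      one_mul]
  rw [h4]
  exact isIntegral_algebraMap.mul hx

end LinearNormalization

/-! ### Shears. -/

section Shear

variable {ι σ : Type} {K : ι → Type} [∀ i, Field (K i)] [∀ i, Algebra ℂ (K i)]

/-- The linear change of coordinates adding multiples of the coordinate `o` to the others. -/
noncomputable def shearAlgHom (o : σ) (δ : σ → ℂ) : MvPolynomial σ ℂ →ₐ[ℂ] MvPolynomial σ ℂ :=
  aeval fun m => X m + C (δ m) * X o

theorem shearAlgHom_comp (o : σ) (δ ε : σ → ℂ) (hε : ε o = 0) (h : ∀ m, δ m + ε m = 0) :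
    (shearAlgHom o ε).comp (shearAlgHom o δ) = AlgHom.id ℂ _ := by
  ext1 m
  simp only [shearAlgHom, AlgHom.comp_apply, aeval_X, map_add, map_mul, algHom_C, algebraMap_eq,
    hε, map_zero, zero_mul, add_zero, AlgHom.id_apply, add_assoc, ← add_mul]
  rw [← map_add, add_comm (ε m), h, map_zero, zero_mul, add_zero]

/-- Shears as automorphisms of the polynomial ring. -/
noncomputable def shearAlgEquiv (o : σ) (δ : σ → ℂ) (hδ : δ o = 0) :
    MvPolynomial σ ℂ ≃ₐ[ℂ] MvPolynomial σ ℂ :=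
  AlgEquiv.ofAlgHom (shearAlgHom o δ) (shearAlgHom o (-δ))
    (shearAlgHom_comp o (-δ) δ hδ (by simp)) (shearAlgHom_comp o δ (-δ) (by simp [hδ]) (by simp))

/-- The effect of a shear on coordinates. -/
def shearTuple (o : σ) (δ : σ → ℂ) (c : ∀ i, σ → K i) : ∀ i, σ → K i :=
  fun i m => c i m + algebraMap ℂ (K i) (δ m) * c i o

theorem aeval_shearAlgEquiv (o : σ) (δ : σ → ℂ) (hδ : δ o = 0) (c : ∀ i, σ → K i) (i : ι)
    (p : MvPolynomial σ ℂ) :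
    aeval (c i) (shearAlgEquiv o δ hδ p) = aeval (shearTuple o δ c i) p := by
  have : (aeval (c i)).comp (shearAlgHom o δ) = aeval (shearTuple o δ c i) := by
    ext m
    simp [shearAlgHom, shearTuple]
  exact congr($this p)

theorem CoordLinked.shear (o : σ) (δ : σ → ℂ) (hδ : δ o = 0) (c : ∀ i, σ → K i) :
    CoordLinked c (shearTuple o δ c) := by
  have := CoordLinked.of_algEquiv (shearAlgEquiv o δ hδ) c
  simpa only [aeval_shearAlgEquiv, aeval_X] using this

theorem SeparatedPoints.shear {o : σ} {δ : σ → ℂ} (hδ : δ o = 0) {c : ∀ i, σ → K i}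
    (hc : SeparatedPoints c) : SeparatedPoints (shearTuple o δ c) := by
  intro i j hij
  obtain ⟨e, h1, h2⟩ := hc i j hij
  refine ⟨(shearAlgEquiv o δ hδ).symm e, ?_, ?_⟩ <;>
    rw [← aeval_shearAlgEquiv o δ hδ, AlgEquiv.apply_symm_apply]
  exacts [h1, h2]

theorem GeneratingTuples.shear {o : σ} {δ : σ → ℂ} (hδ : δ o = 0) {c : ∀ i, σ → K i}
    (hc : GeneratingTuples c) : GeneratingTuples (shearTuple o δ c) := by
  intro i
  rw [← top_le_iff, ← hc i, IntermediateField.adjoin_le_iff]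
  rintro _ ⟨m, rfl⟩
  have h1 (m) : shearTuple o δ c i m ∈
      IntermediateField.adjoin ℂ (Set.range (shearTuple o δ c i)) :=
    IntermediateField.subset_adjoin _ _ ⟨m, rfl⟩
  have h2 : c i m = shearTuple o δ c i m - algebraMap ℂ (K i) (δ m) * shearTuple o δ c i o := by
    simp [shearTuple, hδ]
  rw [h2]
  exact sub_mem (h1 m) (mul_mem (IntermediateField.algebraMap_mem _ _) (h1 o))

end Shear

/-! ### Extending homomorphisms along integral extensions. -/

section Extension

/-- Homomorphisms to algebraically closed fields extend along integral extensions. -/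
theorem exists_ringHom_extension {B A L : Type} [CommRing B] [CommRing A] [Algebra B A]
    [Algebra.IsIntegral B A] [Field L] [IsAlgClosed L] (ψ : B →+* L)
    (h : RingHom.ker (algebraMap B A) ≤ RingHom.ker ψ) :
    ∃ ψ' : A →+* L, ψ'.comp (algebraMap B A) = ψ := by
  have hP : (RingHom.ker ψ).IsPrime := RingHom.ker_isPrime ψ
  -- By lying over there is a prime `Q` above `ker ψ`; then `A ⧸ Q` is algebraic over `B ⧸ ker ψ`
  -- and embeds into `L`.
  obtain ⟨Q, -, hQ, hQP⟩ := Ideal.exists_ideal_over_prime_of_isIntegral (RingHom.ker ψ)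
    (⊥ : Ideal A) h
  have : Q.LiesOver (RingHom.ker ψ) := ⟨hQP.symm⟩
  letI : Algebra (B ⧸ RingHom.ker ψ) L := (RingHom.kerLift ψ).toAlgebra
  have h1 : Module.IsTorsionFree (B ⧸ RingHom.ker ψ) L :=
    Module.isTorsionFree_iff_algebraMap_injective.mpr (RingHom.kerLift_injective ψ)
  have h2 : Module.IsTorsionFree (B ⧸ RingHom.ker ψ) (A ⧸ Q) :=
    Module.isTorsionFree_iff_algebraMap_injective.mpr (FaithfulSMul.algebraMap_injective _ _)
  have h3 : Algebra.IsIntegral (B ⧸ RingHom.ker ψ) (A ⧸ Q) := inferInstance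
  have h4 : Algebra.IsAlgebraic (B ⧸ RingHom.ker ψ) (A ⧸ Q) := Algebra.IsIntegral.isAlgebraic
  let l : A ⧸ Q →ₐ[B ⧸ RingHom.ker ψ] L := IsAlgClosed.lift
  refine ⟨l.toRingHom.comp (Ideal.Quotient.mk Q), ?_⟩
  ext b
  change l (Ideal.Quotient.mk Q (algebraMap B A b)) = ψ b
  rw [← Ideal.Quotient.algebraMap_mk_of_liesOver Q (RingHom.ker ψ), l.commutes]
  rfl

end Extension

/-! ### Generic projections preserve separation and generation. -/

section Projection

/-- With polynomial coefficients, the integral equation can be specialized at other points too. -/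
theorem exists_monic_of_isIntegral_adjoin {τ L : Type} [Field L] [Algebra ℂ L] {t : τ → L} {x : L}
    (h : IsIntegral (Algebra.adjoin ℂ (Set.range t)) x) :
    ∃ f : Polynomial (MvPolynomial τ ℂ), f.Monic ∧
      f.eval₂ (aeval t : MvPolynomial τ ℂ →ₐ[ℂ] L).toRingHom x = 0 := by
  obtain ⟨f, hf, hfx⟩ := h
  have hmem (p : MvPolynomial τ ℂ) : aeval t p ∈ Algebra.adjoin ℂ (Set.range t) := by
    rw [Algebra.adjoin_range_eq_range_aeval]
    exact ⟨p, rfl⟩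
  let φ : MvPolynomial τ ℂ →+* Algebra.adjoin ℂ (Set.range t) :=
    ((aeval t).codRestrict _ hmem).toRingHom
  have hφ : Function.Surjective φ := by
    rintro ⟨y, hy⟩
    rw [Algebra.adjoin_range_eq_range_aeval] at hy
    obtain ⟨p, hp⟩ := hy
    exact ⟨p, Subtype.ext hp⟩
  obtain ⟨g, hg, -, hgm⟩ := Polynomial.lifts_and_natDegree_eq_and_monic
    ((Polynomial.mem_lifts f).mpr (Polynomial.map_surjective φ hφ f)) hf
  refine ⟨g, hgm, ?_⟩
  rw [← hg, Polynomial.eval₂_map] at hfx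
  exact hfx

variable {σ : Type} {L M : Type} [Field L] [Field M] [Algebra ℂ L] [Algebra ℂ M] {p q : σ}

/-- If the coordinates `p`, `q` of a point `a` are integral over the others then a point `b` not in
the closure of `a` stays outside under the projection forgetting the coordinate `p`, after
changing coordinates by all but finitely many shears. -/
theorem finite_setOf_not_separated [DecidableEq σ] (hpq : p ≠ q) {a : σ → L} {b : σ → M}
    (hp : IsIntegral (Algebra.adjoin ℂ (Set.range fun m : {m // m ≠ p ∧ m ≠ q} => a m)) (a p))
    (hq : IsIntegral (Algebra.adjoin ℂ (Set.range fun m : {m // m ≠ p ∧ m ≠ q} => a m)) (a q))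
    (h : ∃ e : MvPolynomial σ ℂ, aeval b e ≠ 0 ∧ aeval a e = 0) :
    {l : ℂ | ¬ ∃ e : MvPolynomial {m // m ≠ p} ℂ,
      aeval (fun m : {m // m ≠ p} => b m + algebraMap ℂ M ((Pi.single q l : σ → ℂ) m) * b p) e ≠ 0 ∧
      aeval (fun m : {m // m ≠ p} => a m + algebraMap ℂ L ((Pi.single q l : σ → ℂ) m) * a p) e = 0
      }.Finite := by
  obtain ⟨f, hf, hfp⟩ := exists_monic_of_isIntegral_adjoin hp
  obtain ⟨g, hg, hgq⟩ := exists_monic_of_isIntegral_adjoin hq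
  obtain ⟨e, he, he'⟩ := h
  let S := {m // m ≠ p ∧ m ≠ q}
  let N := AlgebraicClosure M
  let j : M →ₐ[ℂ] N := IsScalarTower.toAlgHom ℂ M N
  let β : MvPolynomial S ℂ →+* N := (j.comp (aeval fun m : S => b m)).toRingHom
  let f' := f.map β
  let g' := g.map β
  have hf' : f' ≠ 0 := (hf.map β).ne_zero
  have hg' : g' ≠ 0 := (hg.map β).ne_zero
  classical
  -- The candidates for exceptional `l`. If `l` is bad, evaluation at `b` extends to `ψ` on elements
  -- integral over the projected coordinates of `a`. Then `ψ yp`, `ψ yq` are roots of `f'`, `g'`,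
  -- and `b q + l * b p = ψ yq + l * ψ yp` determines `l`.
  let Z := (f'.roots.toFinset ×ˢ g'.roots.toFinset).image fun z : N × N =>
    (z.2 - j (b q)) / (j (b p) - z.1)
  refine Set.Finite.of_injOn (f := algebraMap ℂ N) (t := (Z : Set N)) ?_
    (algebraMap ℂ N).injective.injOn Z.finite_toSet
  intro l hl
  simp only [Set.mem_ofPred_eq, not_exists, not_and, ne_eq] at hl
  let B := MvPolynomial {m // m ≠ p} ℂ
  let ta : {m // m ≠ p} → L := fun m => a m + algebraMap ℂ L ((Pi.single q l : σ → ℂ) m) * a p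
  let tb : {m // m ≠ p} → M := fun m => b m + algebraMap ℂ M ((Pi.single q l : σ → ℂ) m) * b p
  letI : Algebra B L := (aeval ta).toRingHom.toAlgebra
  haveI : IsScalarTower ℂ B L := IsScalarTower.of_algebraMap_eq fun x =>
    ((aeval ta).commutes x).symm
  have hmap (x : B) : algebraMap B L x = aeval ta x := rfl
  let A := integralClosure B L
  have hker : RingHom.ker (algebraMap B A) ≤ RingHom.ker (j.comp (aeval tb)).toRingHom := by
    intro x hx
    have h0 : aeval ta x = 0 := by
      rw [RingHom.mem_ker] at hx
      rw [← hmap, IsScalarTower.algebraMap_apply B A L, hx, map_zero]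
    have h1 : aeval tb x = 0 := by
      by_contra h1
      exact hl x h1 h0
    rw [RingHom.mem_ker]
    change j (aeval tb x) = 0
    rw [h1, map_zero]
  obtain ⟨ψ, hψ⟩ := exists_ringHom_extension (j.comp (aeval tb)).toRingHom hker
  have hψ' (x : B) : ψ (algebraMap B A x) = j (aeval tb x) := congr($hψ x)
  let r : MvPolynomial S ℂ →ₐ[ℂ] B := rename fun m => ⟨m, m.2.1⟩
  have hra : (aeval ta).comp r = aeval fun m : S => a m := by
    ext m
    simp [r, ta, rename_X, Pi.single_eq_of_ne m.2.2]
  have hrb : (aeval tb).comp r = aeval fun m : S => b m := by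
    ext m
    simp [r, tb, rename_X, Pi.single_eq_of_ne m.2.2]
  have hint (f : Polynomial (MvPolynomial S ℂ)) (hf : f.Monic) (x : L)
      (hx : f.eval₂ (aeval fun m : S => a m : MvPolynomial S ℂ →ₐ[ℂ] L).toRingHom x = 0) :
      IsIntegral B x := by
    refine ⟨f.map r.toRingHom, hf.map _, ?_⟩
    rw [Polynomial.eval₂_map, ← hx, ← hra]
    rfl
  have hroot (f : Polynomial (MvPolynomial S ℂ)) (x : L)
      (hx : f.eval₂ (aeval fun m : S => a m : MvPolynomial S ℂ →ₐ[ℂ] L).toRingHom x = 0)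
      (y : A) (hy : (y : L) = x) : (f.map β).eval (ψ y) = 0 := by
    have h1 : f.eval₂ ((algebraMap B A).comp r.toRingHom) y = 0 := by
      apply Subtype.ext
      change A.val.toRingHom _ = _
      rw [Polynomial.hom_eval₂]
      change Polynomial.eval₂ _ (y : L) f = 0
      rw [hy, ← hx, ← hra]
      rfl
    have h2 := congr(ψ $h1)
    rw [map_zero, Polynomial.hom_eval₂] at h2
    rw [Polynomial.eval_map, ← h2]
    congr 1
    refine RingHom.ext fun z => ?_
    change j (aeval (fun m : S => b m) z) = ψ (algebraMap B A (r z))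
    rw [hψ', ← hrb]
    rfl
  let yp : A := ⟨a p, hint f hf _ hfp⟩
  let yq : A := ⟨a q, hint g hg _ hgq⟩
  have hxp : ψ yp ∈ f'.roots := (Polynomial.mem_roots hf').mpr (hroot f _ hfp yp rfl)
  have hxq : ψ yq ∈ g'.roots := (Polynomial.mem_roots hg').mpr (hroot g _ hgq yq rfl)
  have hconst (z : ℂ) : ψ (algebraMap B A (C z)) = algebraMap ℂ N z := by
    rw [hψ', algHom_C, AlgHom.commutes]
  have hrel : j (b q) + algebraMap ℂ N l * j (b p) = ψ yq + algebraMap ℂ N l * ψ yp := by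
    have h1 : algebraMap B A (X ⟨q, hpq.symm⟩) = yq + algebraMap B A (C l) * yp := by
      apply Subtype.ext
      change algebraMap B L (X ⟨q, hpq.symm⟩) = a q + algebraMap B L (C l) * a p
      rw [hmap, hmap, aeval_X, algHom_C]
      simp [ta]
    have h2 := congr(ψ $h1)
    rw [map_add, map_mul, hconst, hψ', aeval_X] at h2
    rw [← h2]
    simp [tb]
  -- Otherwise `ψ` would send every coordinate of `a` to that of `b`, and `e` would vanish at `b`
  -- because it vanishes at `a`.
  have hne : j (b p) ≠ ψ yp := by
    intro hbp
    rw [hbp, add_left_inj] at hrel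
    let cA : σ → A := fun m => if h : m = p then yp else if m = q then yq else
      algebraMap B A (X ⟨m, h⟩)
    have hcA : ∀ m, (cA m : L) = a m := by
      intro m
      by_cases h1 : m = p
      · subst h1; simp [cA, yp]
      · by_cases h2 : m = q
        · subst h2; simp [cA, h1, yq]
        · simp only [cA, h1, h2, dite_false, if_false]
          change algebraMap B L _ = _
          rw [hmap, aeval_X]
          simp [ta, Pi.single_eq_of_ne h2]
    have hcA' : ∀ m, ψ (cA m) = j (b m) := by
      intro m
      by_cases h1 : m = p
      · subst h1; simp [cA, hbp]
      · by_cases h2 : m = q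
        · subst h2; simp [cA, h1, hrel]
        · simp only [cA, h1, h2, dite_false, if_false]
          rw [hψ', aeval_X]
          simp [tb, Pi.single_eq_of_ne h2]
    have h1 : eval₂ ((algebraMap B A).comp C) cA e = 0 := by
      apply Subtype.ext
      change A.val.toRingHom _ = _
      rw [hom_eval₂]
      change eval₂ _ _ e = 0
      rw [← he', aeval_def]
      congr 1
      · refine RingHom.ext fun z => ?_
        change algebraMap B L (C z) = _
        rw [hmap, algHom_C]
      · funext m
        exact hcA m
    have h2 := congr(ψ $h1)
    rw [map_zero, hom_eval₂] at h2
    refine he ((map_eq_zero_iff j j.toRingHom.injective).mp ?_)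
    rw [← h2, aeval_def, ← AlgHom.coe_toRingHom, hom_eval₂]
    congr 1
    · refine RingHom.ext fun z => ?_
      change j (algebraMap ℂ M z) = ψ (algebraMap B A (C z))
      rw [hconst, j.commutes]
    · funext m
      exact (hcA' m).symm
  refine Finset.mem_coe.mpr (Finset.mem_image.mpr ⟨(ψ yp, ψ yq), ?_, ?_⟩)
  · exact Finset.mem_product.mpr ⟨Multiset.mem_toFinset.mpr hxp, Multiset.mem_toFinset.mpr hxq⟩
  · rw [div_eq_iff (sub_ne_zero.mpr hne)]
    linear_combination -hrel

open AlgebraicIndependent in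
/-- Generic linear combinations of two generators generate. -/
theorem finite_setOf_adjoin_ne_top [Algebra.EssFiniteType ℂ L] (A : Set L) (x y : L)
    (hA : (matroid ℂ L).Spanning A) (hxy : IntermediateField.adjoin ℂ (insert x (insert y A)) = ⊤) :
    {l : ℂ | IntermediateField.adjoin ℂ (insert (y + algebraMap ℂ L l * x) A) ≠ ⊤}.Finite := by
  let F := IntermediateField.adjoin ℂ A
  have : Finite (IntermediateField F L) := finite_intermediateField_of_spanning A hA
  let E (l : ℂ) : IntermediateField F L := IntermediateField.adjoin F {y + algebraMap ℂ L l * x}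
  have hE (l) : y + algebraMap ℂ L l * x ∈ E l := IntermediateField.mem_adjoin_simple_self F _
  have hC (l l' : ℂ) : algebraMap ℂ L l ∈ E l' :=
    ((E l').restrictScalars ℂ).algebraMap_mem l
  -- Two different values of `l` with the same field `E l` force `x` and `y` into it, so `E l` is
  -- everything. There are only finitely many intermediate fields.
  refine Set.Finite.of_injOn (f := E) (t := Set.univ) (Set.mapsTo_univ _ _) ?_ Set.finite_univ
  intro l hl l' _ hll'
  by_contra hne
  refine hl (IntermediateField.adjoin_insert_eq_top ?_)
  change E l = ⊤
  have h1 : y + algebraMap ℂ L l' * x ∈ E l := hll' ▸ hE l'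
  have hx : x ∈ E l := by
    have h2 := mul_mem (hC (l - l')⁻¹ l) (sub_mem (hE l) h1)
    have h3 : algebraMap ℂ L (l - l') ≠ 0 := by
      rw [map_ne_zero_iff _ (algebraMap ℂ L).injective]
      exact sub_ne_zero.mpr hne
    have h4 : algebraMap ℂ L (l - l')⁻¹ * (y + algebraMap ℂ L l * x -
        (y + algebraMap ℂ L l' * x)) = x := by
      rw [map_inv₀, inv_mul_eq_iff_eq_mul₀ h3, map_sub]
      ring
    rwa [h4] at h2
  have hy : y ∈ E l := by
    have := sub_mem (hE l) (mul_mem (hC l l) hx)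
    rwa [add_sub_cancel_right] at this
  have hle : IntermediateField.adjoin ℂ (insert x (insert y A)) ≤ (E l).restrictScalars ℂ := by
    rw [IntermediateField.adjoin_le_iff]
    refine Set.insert_subset hx (Set.insert_subset hy fun z hz => ?_)
    exact (E l).algebraMap_mem ⟨z, IntermediateField.subset_adjoin ℂ A hz⟩
  rw [hxy] at hle
  exact eq_top_iff.mpr fun z _ => hle (IntermediateField.mem_top (x := z))

end Projection

/-! ### Putting a family into prepared position. -/

section Preparation

open AlgebraicIndependent in
-- The elements algebraic over `ℂ[A]` form a field containing `A`, `x` and `y`.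
theorem spanning_of_adjoin_insert_eq_top {L : Type} [Field L] [Algebra ℂ L] (A : Set L) (x y : L)
    (hx : IsIntegral (Algebra.adjoin ℂ A) x) (hy : IsIntegral (Algebra.adjoin ℂ A) y)
    (hxy : IntermediateField.adjoin ℂ (insert x (insert y A)) = ⊤) :
    (matroid ℂ L).Spanning A := by
  rw [matroid_spanning_iff]
  let T : IntermediateField ℂ L := Subalgebra.toIntermediateField
    ((Subalgebra.algebraicClosure (Algebra.adjoin ℂ A) L).restrictScalars ℂ)
    fun z hz => IsAlgebraic.inv hz
  have hle : IntermediateField.adjoin ℂ (insert x (insert y A)) ≤ T := by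
    rw [IntermediateField.adjoin_le_iff]
    refine Set.insert_subset hx.isAlgebraic (Set.insert_subset hy.isAlgebraic fun z hz => ?_)
    exact isAlgebraic_algebraMap (⟨z, Algebra.subset_adjoin hz⟩ : Algebra.adjoin ℂ A)
  rw [hxy] at hle
  exact ⟨fun z => hle (IntermediateField.mem_top (x := z))⟩

theorem IsIntegral.of_adjoin_of_forall {L : Type} [Field L] [Algebra ℂ L] {A B : Set L} {x : L}
    (hx : IsIntegral (Algebra.adjoin ℂ B) x)
    (h : ∀ z ∈ B, IsIntegral (Algebra.adjoin ℂ A) z) : IsIntegral (Algebra.adjoin ℂ A) x := by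
  let C := integralClosure (Algebra.adjoin ℂ A) L
  have hle : Algebra.adjoin ℂ B ≤ C.restrictScalars ℂ := Algebra.adjoin_le h
  letI : Algebra (Algebra.adjoin ℂ B) C := (Subalgebra.inclusion hle).toAlgebra
  haveI : IsScalarTower (Algebra.adjoin ℂ B) C L := IsScalarTower.of_algebraMap_eq fun _ => rfl
  exact isIntegral_trans (A := C) x (hx.tower_top (A := C))

namespace CoordLinked

variable {ι σ : Type} {K : ι → Type} [∀ i, Field (K i)] [∀ i, Algebra ℂ (K i)]
  [Finite ι] [DecidableEq σ] [Finite σ]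

/-- Linear coordinates in which two coordinates of all points are integral over the others. -/
theorem exists_shear_isIntegral {c : ∀ i, σ → K i} {p q : σ} (hpq : p ≠ q)
    (hs : SeparatedPoints c) (hg : GeneratingTuples c)
    (htr : ∀ i (t : {m // m ≠ p} → K i), ¬ AlgebraicIndependent ℂ t) :
    ∃ d : ∀ i, σ → K i, CoordLinked c d ∧ SeparatedPoints d ∧ GeneratingTuples d ∧
      ∀ i, IsIntegral (Algebra.adjoin ℂ (Set.range fun m : {m // m ≠ p ∧ m ≠ q} => d i m)) (d i p) ∧
        IsIntegral (Algebra.adjoin ℂ (Set.range fun m : {m // m ≠ p ∧ m ≠ q} => d i m)) (d i q) := by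
  obtain ⟨δ, hδ, h1⟩ := exists_linear_isIntegral c p fun i h =>
    htr i _ (h.comp Subtype.val Subtype.val_injective)
  obtain ⟨c', hc'⟩ : ∃ c', c' = shearTuple p δ c := ⟨_, rfl⟩
  have hc'p (i) : c' i p = c i p := by simp [hc', shearTuple, hδ]
  have h1' : ∀ i, IsIntegral (Algebra.adjoin ℂ (Set.range fun m : {m // m ≠ p} => c' i m))
      (c' i p) := fun i => by
    rw [hc'p, hc']
    exact h1 i
  obtain ⟨ε, hε, h2⟩ := exists_linear_isIntegral (fun i (m : {m // m ≠ p}) => c' i m)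
    ⟨q, hpq.symm⟩ fun i => htr i _
  let ε' : σ → ℂ := fun m => if h : m ≠ p then ε ⟨m, h⟩ else 0
  have hε'p : ε' p = 0 := by simp [ε']
  have hε'q : ε' q = 0 := by simp [ε', hpq.symm, hε]
  have hε' (m : {m // m ≠ p}) : ε' m = ε m := by simp [ε', m.2]
  obtain ⟨d, hd⟩ : ∃ d, d = shearTuple q ε' c' := ⟨_, rfl⟩
  have hdp (i) : d i p = c' i p := by simp [hd, shearTuple, hε'p]
  have hdq (i) : d i q = c' i q := by simp [hd, shearTuple, hε'q]
  have h2' : ∀ i, IsIntegral (Algebra.adjoin ℂ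
      (Set.range fun m : {m // m ≠ p ∧ m ≠ q} => d i m)) (d i q) := fun i => by
    rw [hdq]
    have hrange : (Set.range fun m : {m // m ≠ p ∧ m ≠ q} => d i m) = Set.range fun m :
        {m : {m // m ≠ p} // m ≠ ⟨q, hpq.symm⟩} =>
          c' i m + algebraMap ℂ (K i) (ε m) * c' i q := by
      ext z
      constructor
      · rintro ⟨m, rfl⟩
        refine ⟨⟨⟨m, m.2.1⟩, fun h => m.2.2 (congrArg Subtype.val h)⟩, ?_⟩
        simp only [hd, shearTuple, ← hε']
      · rintro ⟨m, rfl⟩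
        refine ⟨⟨m.1, m.1.2, fun h => m.2 (Subtype.ext h)⟩, ?_⟩
        simp only [hd, shearTuple, ← hε']
    rw [hrange]
    exact h2 i
  refine ⟨d, ?_, ?_, ?_, fun i => ⟨?_, h2' i⟩⟩
  · rw [hd, hc']
    exact (CoordLinked.shear p δ hδ c).trans (CoordLinked.shear q ε' hε'q _)
  · rw [hd, hc']
    exact (hs.shear hδ).shear hε'q
  · rw [hd, hc']
    exact (hg.shear hδ).shear hε'q
  · rw [hdp]
    -- The second shear changes the coordinates over which `p` is integral only by multiples of `q`,
    -- which is itself integral over the rest.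
    refine (h1' i).of_adjoin_of_forall ?_
    rintro _ ⟨m, rfl⟩
    by_cases hm : m = q
    · simp only [hm, ← hdq]
      exact h2' i
    · have h3 : c' i m = d i m - algebraMap ℂ (K i) (ε' m) * d i q := by
        rw [hdq]
        simp [hd, shearTuple]
      simp only [h3]
      refine IsIntegral.sub ?_ (IsIntegral.mul ?_ (h2' i))
      · exact isIntegral_algebraMap (x := (⟨d i m, Algebra.subset_adjoin ⟨⟨m, m.2, hm⟩, rfl⟩⟩ :
          Algebra.adjoin ℂ (Set.range fun m : {m // m ≠ p ∧ m ≠ q} => d i m)))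
      · exact (isIntegral_algebraMap (R := ℂ)).tower_top

/-- Every family of separated points is linked to a prepared one. -/
theorem exists_prepared {c : ∀ i, σ → K i} {p q : σ} (hpq : p ≠ q)
    (hs : SeparatedPoints c) (hg : GeneratingTuples c)
    (htr : ∀ i (t : {m // m ≠ p} → K i), ¬ AlgebraicIndependent ℂ t) (N : ι → ℂ) :
    ∃ d : ∀ i, σ → K i, CoordLinked c d ∧ Prepared d p N {⟨q, hpq.symm⟩} := by
  obtain ⟨a, hca, has, hag, hint⟩ := exists_shear_isIntegral hpq hs hg htr
  let A (i) : Set (K i) := Set.range fun m : {m // m ≠ p ∧ m ≠ q} => a i m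
  have htop (i) : IntermediateField.adjoin ℂ (insert (a i p) (insert (a i q) (A i))) = ⊤ := by
    rw [← top_le_iff, ← hag i]
    refine IntermediateField.adjoin.mono _ _ _ ?_
    rintro _ ⟨m, rfl⟩
    by_cases h1 : m = p
    · exact Or.inl (by rw [h1])
    · by_cases h2 : m = q
      · exact Or.inr (Or.inl (by rw [h2]))
      · exact Or.inr (Or.inr ⟨⟨m, h1, h2⟩, rfl⟩)
  have hspan (i) : (AlgebraicIndependent.matroid ℂ (K i)).Spanning (A i) :=
    spanning_of_adjoin_insert_eq_top _ _ _ (hint i).1 (hint i).2 (htop i)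
  have hess (i) : Algebra.EssFiniteType ℂ (K i) := by
    rw [← IntermediateField.fg_top_iff, ← hag i]
    exact IntermediateField.fg_adjoin_of_finite (Set.finite_range _)
  have hbad1 (i) := finite_setOf_adjoin_ne_top (A i) (a i p) (a i q) (hspan i) (htop i)
  have hbad2 (z : {z : ι × ι // z.1 ≠ z.2}) :=
    finite_setOf_not_separated hpq (hint z.1.2).1 (hint z.1.2).2 (has z.1.1 z.1.2 z.2)
  -- Only finitely many `l` spoil generation or separation of the projections forgetting `p`.
  obtain ⟨l, hl⟩ := ((Set.finite_iUnion hbad1).union (Set.finite_iUnion hbad2)).exists_notMem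
  simp only [Set.mem_union, Set.mem_iUnion, not_or, not_exists, Set.mem_ofPred_eq,
    not_not] at hl
  obtain ⟨hl1, hl2⟩ := hl
  have hδ : (Pi.single q l : σ → ℂ) p = 0 := Pi.single_eq_of_ne hpq _
  obtain ⟨b, hb⟩ : ∃ b, b = shearTuple p (Pi.single q l) a := ⟨_, rfl⟩
  have hb' (i) (m) (h : m ≠ q) : b i m = a i m := by simp [hb, shearTuple, Pi.single_eq_of_ne h]
  have hbs : SeparatedPoints fun i (m : {m // m ≠ p}) => b i m := by
    intro i j hij
    simpa only [hb, shearTuple] using not_forall_not.mp (hl2 ⟨(i, j), hij⟩)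
  have hbg : GeneratingTuples fun i (m : {m // m ≠ p}) => b i m := by
    intro i
    rw [← hl1 i]
    congr 1
    ext z
    constructor
    · rintro ⟨m, rfl⟩
      by_cases h : m = q
      · exact Or.inl (by simp [h, hb, shearTuple])
      · exact Or.inr ⟨⟨m, m.2, h⟩, (hb' i m h).symm⟩
    · rintro (rfl | ⟨m, rfl⟩)
      · exact ⟨⟨q, hpq.symm⟩, by simp [hb, shearTuple]⟩
      · exact ⟨⟨m, m.2.1⟩, hb' i m m.2.2⟩
  -- The coordinate `p` is now free and is set to the constants `N i`.
  have hlink := update_of_generatingTuples b p hbs hbg fun i => algebraMap ℂ (K i) (N i)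
  refine ⟨fun i => Function.update (b i) p (algebraMap ℂ (K i) (N i)),
    (hca.trans (by rw [hb]; exact CoordLinked.shear p _ hδ a)).trans hlink, fun i => by simp, ?_, ?_⟩
  · have h : (fun i (m : {m // m ≠ p}) => Function.update (b i) p (algebraMap ℂ (K i) (N i)) m) =
        fun i (m : {m // m ≠ p}) => b i m := by
      funext i m
      rw [Function.update_of_ne m.2]
    rw [h]
    exact hbg
  · rintro i _ rfl
    convert hspan i using 1
    ext z
    constructor
    · rintro ⟨m, hm, rfl⟩
      have h2 : (m : σ) ≠ q := fun h => hm (Subtype.ext h)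
      exact ⟨⟨m, m.2, h2⟩, by simp only [Function.update_of_ne m.2, hb' i m h2]⟩
    · rintro ⟨m, rfl⟩
      exact ⟨⟨m, m.2.1⟩, fun h => m.2.2 (congrArg Subtype.val h), by
        simp only [Function.update_of_ne m.2.1, hb' i m m.2.2]⟩

/-- Two families of separated points with the same residue fields are linked if the
dimension of their closures is small. -/
theorem of_separatedPoints {c d : ∀ i, σ → K i} {p q : σ} (hpq : p ≠ q)
    (hc : SeparatedPoints c) (hcg : GeneratingTuples c)
    (hd : SeparatedPoints d) (hdg : GeneratingTuples d)
    (htr : ∀ i (t : {m // m ≠ p} → K i), ¬ AlgebraicIndependent ℂ t) : CoordLinked c d := by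
  obtain ⟨n, ⟨e⟩⟩ := Finite.exists_equiv_fin ι
  let N : ι → ℂ := fun i => ((e i : ℕ) : ℂ)
  have hN : N.Injective := fun i j h => e.injective (Fin.ext (Nat.cast_injective h))
  obtain ⟨c', h1, h1'⟩ := exists_prepared hpq hc hcg htr N
  obtain ⟨d', h2, h2'⟩ := exists_prepared hpq hd hdg htr N
  exact (h1.trans (of_prepared hN _ h1' h2' htr)).trans h2.symm

end CoordLinked

end Preparation

/-! ### Affine charts of projective space. -/

section Charts

attribute [local instance] MvPolynomial.gradedAlgebra

open HomogeneousLocalization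

theorem MvPolynomial.IsHomogeneous.aeval_mul_right {σ A : Type} [CommRing A] [Algebra ℂ A]
    {p : MvPolynomial σ ℂ} {n : ℕ} (hp : p.IsHomogeneous n) (x : σ → A) (u : A) :
    MvPolynomial.aeval (fun k => x k * u) p = MvPolynomial.aeval x p * u ^ n := by
  rw [aeval_def, aeval_def, MvPolynomial.eval₂_eq, MvPolynomial.eval₂_eq, Finset.sum_mul]
  refine Finset.sum_congr rfl fun d hd => ?_
  have h : ∑ k ∈ d.support, d k = n := by
    rw [hp.degree_eq_sum_deg_support hd]
  rw [mul_assoc, ← h, ← Finset.prod_pow_eq_pow_sum, ← Finset.prod_mul_distrib]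
  simp only [mul_pow]

variable {r : ℕ}

/-- The linear form with the given coefficients. -/
noncomputable def linearForm (c : Fin (r + 1) → ℂ) : MvPolynomial (Fin (r + 1)) ℂ :=
  ∑ k, C (c k) * X k

theorem linearForm_mem (c : Fin (r + 1) → ℂ) :
    linearForm c ∈ homogeneousSubmodule (Fin (r + 1)) ℂ 1 :=
  IsHomogeneous.sum _ _ _ fun _ _ => isHomogeneous_C_mul_X _ _

/-- Dehomogenization with respect to a linear form. -/
noncomputable def dehomogenize (c : Fin (r + 1) → ℂ) :
    MvPolynomial (Fin (r + 1)) ℂ →ₐ[ℂ] MvPolynomial (Fin r) ℂ :=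
  -- The variable `X 0` is replaced by the solution of `linearForm c = 1`.
  aeval (Fin.cons (C (c 0)⁻¹ * (1 - ∑ k : Fin r, C (c k.succ) * X k)) X)

theorem dehomogenize_linearForm {c : Fin (r + 1) → ℂ} (hc : c 0 ≠ 0) :
    dehomogenize c (linearForm c) = 1 := by
  have h : (C (c 0) * C (c 0)⁻¹ : MvPolynomial (Fin r) ℂ) = 1 := by
    rw [← C_mul, mul_inv_cancel₀ hc, C_1]
  simp only [dehomogenize, linearForm, Fin.sum_univ_succ]
  simp only [map_add, map_mul, map_sum, algHom_C, aeval_X, Fin.cons_zero, Fin.cons_succ,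
    algebraMap_eq]
  rw [← mul_assoc, h]
  ring

/-- The ring map from the coordinate ring of the complement of a hyperplane to the polynomial
ring. -/
noncomputable def awayToPolynomial {c : Fin (r + 1) → ℂ} (hc : c 0 ≠ 0) :
    Away (homogeneousSubmodule (Fin (r + 1)) ℂ) (linearForm c) →+* MvPolynomial (Fin r) ℂ :=
  (IsLocalization.Away.lift (S := Localization.Away (linearForm c)) (linearForm c)
    (g := (dehomogenize c).toRingHom) (by
      change IsUnit (dehomogenize c (linearForm c))
      rw [dehomogenize_linearForm hc]; exact isUnit_one)).comp
    (algebraMap (Away (homogeneousSubmodule (Fin (r + 1)) ℂ) (linearForm c))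
      (Localization.Away (linearForm c)))

theorem awayToPolynomial_mk {c : Fin (r + 1) → ℂ} (hc : c 0 ≠ 0) (n : ℕ)
    (p : MvPolynomial (Fin (r + 1)) ℂ) (hp) :
    awayToPolynomial hc (Away.mk _ (linearForm_mem c) n p hp) = dehomogenize c p := by
  have h : IsUnit ((dehomogenize c).toRingHom (linearForm c)) := by
    change IsUnit (dehomogenize c (linearForm c))
    rw [dehomogenize_linearForm hc]; exact isUnit_one
  change IsLocalization.Away.lift (linearForm c) h
    (Localization.mk p (⟨linearForm c ^ n, n, rfl⟩ : Submonoid.powers (linearForm c))) = _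
  rw [Localization.mk_eq_mk', IsLocalization.Away.lift, IsLocalization.lift_mk'_spec]
  change dehomogenize c p = dehomogenize c (linearForm c ^ n) * _
  rw [map_pow, dehomogenize_linearForm hc, one_pow, one_mul]

theorem awayToPolynomial_comp_algebraMap {c : Fin (r + 1) → ℂ} (hc : c 0 ≠ 0) :
    (awayToPolynomial hc).comp ((fromZeroRingHom _ _).comp
      (algebraMap ℂ (homogeneousSubmodule (Fin (r + 1)) ℂ 0))) =
    algebraMap ℂ (MvPolynomial (Fin r) ℂ) := by
  ext z
  have h : fromZeroRingHom (homogeneousSubmodule (Fin (r + 1)) ℂ) (Submonoid.powers (linearForm c))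
      (algebraMap ℂ _ z) = Away.mk _ (linearForm_mem c) 0 (C z)
        ((zero_smul ℕ 1).symm ▸ isHomogeneous_C _ _) := by
    ext
    simp only [Away.val_mk]
    rfl
  simp only [RingHom.comp_apply, h, awayToPolynomial_mk, algHom_C]

/-- The localization of the homogeneous coordinate ring at a linear form. -/
abbrev LinearFormLocalization (c : Fin (r + 1) → ℂ) : Type :=
  Localization (Submonoid.powers (linearForm c))

/-- The inverse `φ` sends `X k` to `X k.succ / linearForm c`. It is checked in the full
localization, where dehomogenizing and applying `φ` multiplies a form of degree `n` by `u ^ n`. -/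
theorem awayToPolynomial_bijective {c : Fin (r + 1) → ℂ} (hc : c 0 ≠ 0) :
    Function.Bijective (awayToPolynomial hc) := by
  let u : LinearFormLocalization c :=
    Localization.mk 1 ⟨linearForm c, Submonoid.mem_powers _⟩
  have hu : algebraMap _ (LinearFormLocalization c) (linearForm c) * u = 1 := by
    simp only [u]
    rw [Localization.mk_eq_mk', IsLocalization.mk'_spec'_mk, map_one]
  let φ : MvPolynomial (Fin r) ℂ →+* Away (homogeneousSubmodule (Fin (r + 1)) ℂ) (linearForm c) :=
    eval₂Hom ((fromZeroRingHom _ _).comp (algebraMap ℂ (homogeneousSubmodule (Fin (r + 1)) ℂ 0)))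
      fun k => Away.mk _ (linearForm_mem c) 1 (X k.succ) (by simpa using isHomogeneous_X ℂ k.succ)
  have h1 : (awayToPolynomial hc).comp φ = RingHom.id _ := by
    refine MvPolynomial.ringHom_ext (fun z => ?_) fun k => ?_
    · simp only [φ, RingHom.comp_apply, eval₂Hom_C]
      exact congr($(awayToPolynomial_comp_algebraMap hc) z)
    · simp only [φ, RingHom.comp_apply, eval₂Hom_X', RingHom.id_apply]
      rw [awayToPolynomial_mk, dehomogenize, aeval_X, Fin.cons_succ]
  let G : MvPolynomial (Fin (r + 1)) ℂ →ₐ[ℂ] LinearFormLocalization c :=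
    aeval fun k => algebraMap (MvPolynomial (Fin (r + 1)) ℂ) (LinearFormLocalization c) (X k) * u
  have hG (n) (p : MvPolynomial (Fin (r + 1)) ℂ) (hp : p.IsHomogeneous n) :
      G p = algebraMap _ (LinearFormLocalization c) p * u ^ n := by
    simp only [G]
    rw [IsHomogeneous.aeval_mul_right hp]
    congr 1
    have : (aeval (fun k : Fin (r + 1) => algebraMap (MvPolynomial (Fin (r + 1)) ℂ) (LinearFormLocalization c)
        (X k)) :
        MvPolynomial (Fin (r + 1)) ℂ →ₐ[ℂ] LinearFormLocalization c) =
        IsScalarTower.toAlgHom ℂ (MvPolynomial (Fin (r + 1)) ℂ) (LinearFormLocalization c) := by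
      ext k; simp
    rw [this]; rfl
  have hval : (algebraMap _ (LinearFormLocalization c)).comp (φ.comp (dehomogenize c).toRingHom) =
      G.toRingHom := by
    have hC (z : ℂ) : (φ (C z)).val = algebraMap ℂ (LinearFormLocalization c) z := by
      simp only [φ, eval₂Hom_C]; rfl
    have hX (k : Fin r) : (φ (X k)).val = algebraMap (MvPolynomial (Fin (r + 1)) ℂ) (LinearFormLocalization c) (X k.succ) * u := by
      simp only [φ, eval₂Hom_X', Away.val_mk, u]
      rw [← Localization.mk_one_eq_algebraMap, Localization.mk_mul]
      simp
    refine MvPolynomial.ringHom_ext (fun z => ?_) fun k => ?_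
    · change (φ (dehomogenize c (C z))).val = G (C z)
      rw [algHom_C, algHom_C, ← hC]; rfl
    · change (φ (dehomogenize c (X k))).val = G (X k)
      refine Fin.cases ?_ (fun k => ?_) k
      · simp only [dehomogenize, aeval_X, Fin.cons_zero, map_mul, map_sub, map_one, map_sum,
          val_mul, hC, G]
        change _ * algebraMap (Away (homogeneousSubmodule (Fin (r + 1)) ℂ) (linearForm c))
          (LinearFormLocalization c) _ = _
        simp only [map_sub, map_one, map_sum, map_mul,
          HomogeneousLocalization.algebraMap_apply, hC, hX]
        have h2 : algebraMap _ (LinearFormLocalization c) (linearForm c) * u =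
            algebraMap ℂ (LinearFormLocalization c) (c 0) *
              (algebraMap (MvPolynomial (Fin (r + 1)) ℂ) (LinearFormLocalization c) (X 0) * u) +
            ∑ k : Fin r, algebraMap ℂ (LinearFormLocalization c) (c k.succ) *
              (algebraMap (MvPolynomial (Fin (r + 1)) ℂ) (LinearFormLocalization c) (X k.succ) * u) := by
          have h3 : linearForm c = C (c 0) * X 0 + ∑ k : Fin r, C (c k.succ) * X k.succ :=
            Fin.sum_univ_succ _
          have h4 := congr(algebraMap _ (LinearFormLocalization c) $h3)
          simp only [map_add, map_sum, map_mul] at h4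
          rw [h4, add_mul, Finset.sum_mul]
          simp only [mul_assoc]
          rfl
        rw [← hu, h2, add_sub_cancel_right, ← mul_assoc, ← map_mul, inv_mul_cancel₀ hc, map_one,
          one_mul]
      · simp only [dehomogenize, aeval_X, Fin.cons_succ, hX, G]
  refine ⟨?_, fun p => ⟨φ p, congr($h1 p)⟩⟩
  intro a b hab
  have key (a) : φ (awayToPolynomial hc a) = a := by
    obtain ⟨n, p, hp, rfl⟩ := Away.mk_surjective (𝒜 := homogeneousSubmodule (Fin (r + 1)) ℂ)
      (linearForm_mem c) a
    rw [awayToPolynomial_mk]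
    refine HomogeneousLocalization.val_injective _ ?_
    have h3 : (φ (dehomogenize c p)).val = G p := congr($hval p)
    rw [h3, hG n p (by simpa using hp), Away.val_mk]
    simp only [u]
    rw [← Localization.mk_one_eq_algebraMap, Localization.mk_pow, Localization.mk_mul]
    congr 1
    · simp
    · simp
  rw [← key a, ← key b, hab]

/-- The affine chart on the complement of a hyperplane. -/
noncomputable def hyperplaneChart {c : Fin (r + 1) → ℂ} (hc : c 0 ≠ 0) :
    Spec (CommRingCat.of (MvPolynomial (Fin r) ℂ)) ⟶ Cremona.ProjSpace r :=
  Spec.map (CommRingCat.ofHom (awayToPolynomial hc)) ≫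
    Proj.awayι _ (linearForm c) (linearForm_mem c) one_pos

theorem hyperplaneChart_isIso {c : Fin (r + 1) → ℂ} (hc : c 0 ≠ 0) :
    IsIso (Spec.map (CommRingCat.ofHom (awayToPolynomial hc))) := by
  have : IsIso (CommRingCat.ofHom (awayToPolynomial hc)) :=
    (ConcreteCategory.isIso_iff_bijective _).mpr (awayToPolynomial_bijective hc)
  infer_instance

instance {c : Fin (r + 1) → ℂ} (hc : c 0 ≠ 0) : IsOpenImmersion (hyperplaneChart hc) := by
  have := hyperplaneChart_isIso hc
  exact IsOpenImmersion.comp _ _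

theorem hyperplaneChart_structureMap {c : Fin (r + 1) → ℂ} (hc : c 0 ≠ 0) :
    hyperplaneChart hc ≫ Cremona.structureMap r = affineStructureMap (Fin r) := by
  rw [hyperplaneChart, Cremona.structureMap, Category.assoc, Proj.awayι_toSpecZero_assoc,
    ← Spec.map_comp, ← Spec.map_comp, affineStructureMap, ← CommRingCat.ofHom_comp,
    ← CommRingCat.ofHom_comp, awayToPolynomial_comp_algebraMap hc]

theorem opensRange_hyperplaneChart {c : Fin (r + 1) → ℂ} (hc : c 0 ≠ 0) :
    (hyperplaneChart hc).opensRange = Proj.basicOpen _ (linearForm c) := by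
  have := hyperplaneChart_isIso hc
  exact (Scheme.Hom.opensRange_comp_of_isIso _ _).trans (Proj.opensRange_awayι _ _ _ _)

theorem exists_X_notMem (x : Cremona.ProjSpace r) : ∃ k, X k ∉ x.asHomogeneousIdeal := by
  by_contra! h
  refine x.not_irrelevant_le ((HomogeneousIdeal.irrelevant_le _).mpr fun n hn p hp => ?_)
  change p ∈ x.asHomogeneousIdeal.toIdeal
  rw [← p.support_sum_monomial_coeff]
  refine sum_mem fun d hd => ?_
  have hd' : coeff d p ≠ 0 := mem_support_iff.mp hd
  have h0 : d ≠ 0 := by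
    rintro rfl
    have h2 := IsHomogeneous.degree_eq_sum_deg_support (φ := p) hp hd
    simp only [Finsupp.support_zero, Finset.sum_empty] at h2
    omega
  obtain ⟨k, hk⟩ := Finsupp.ne_iff.mp h0
  exact Ideal.mem_of_dvd _ (X_dvd_monomial.mpr (Or.inr hk)) (h k)

/-- Any finite set of points lies in a chart. -/
theorem exists_chart {ι : Type} [Finite ι] (x : ι → Cremona.ProjSpace r) :
    ∃ f : Spec (CommRingCat.of (MvPolynomial (Fin r) ℂ)) ⟶ Cremona.ProjSpace r,
      IsOpenImmersion f ∧ f ≫ Cremona.structureMap r = affineStructureMap (Fin r) ∧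
        ∀ i, x i ∈ Set.range f := by
  let Λ : (Fin (r + 1) → ℂ) →ₗ[ℂ] MvPolynomial (Fin (r + 1)) ℂ :=
    Fintype.linearCombination ℂ X
  have hΛ (c) : Λ c = linearForm c := by
    simp [Λ, Fintype.linearCombination_apply, linearForm, smul_eq_C_mul]
  -- The coefficient vectors to avoid form finitely many subspaces: `c 0 = 0`, and for each `i` the
  -- linear forms vanishing at `x i`. The latter is proper because some variable does not vanish
  -- there.
  let p : Option ι → Submodule ℂ (Fin (r + 1) → ℂ) := fun o => o.elim
    (LinearMap.ker (LinearMap.proj 0))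
    fun i => ((x i).asHomogeneousIdeal.toIdeal.restrictScalars ℂ).comap Λ
  have hp : ∃ c, ∀ o, c ∉ p o := by
    by_contra! H
    obtain ⟨o, ho⟩ := Subspace.exists_eq_top_of_iUnion_eq_univ (p := p)
      (Set.eq_univ_of_forall fun c => Set.mem_iUnion.mpr (H c))
    cases o with
    | none =>
      have : (1 : Fin (r + 1) → ℂ) ∈ p none := ho ▸ Submodule.mem_top
      simp [p] at this
    | some i =>
      obtain ⟨k, hk⟩ := exists_X_notMem (x i)
      have : (Pi.single k 1 : Fin (r + 1) → ℂ) ∈ p (some i) := ho ▸ Submodule.mem_top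
      refine hk ?_
      have h2 : Λ (Pi.single k 1) ∈ (x i).asHomogeneousIdeal := this
      simpa [Λ] using h2
  obtain ⟨c, hc⟩ := hp
  have h0 : c 0 ≠ 0 := hc none
  refine ⟨hyperplaneChart h0, inferInstance, hyperplaneChart_structureMap h0, fun i => ?_⟩
  have : x i ∈ Proj.basicOpen _ (linearForm c) := by
    rw [Proj.mem_basicOpen, ← hΛ]
    exact hc (some i)
  rw [← opensRange_hyperplaneChart h0] at this
  exact this

/-- Any two points lie in a common chart, and the chart is irreducible. -/
instance (r : ℕ) : PreirreducibleSpace (Cremona.ProjSpace r) := by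
  refine ⟨?_⟩
  rintro U V hU hV ⟨x, -, hx⟩ ⟨y, -, hy⟩
  obtain ⟨f, -, -, hf⟩ := exists_chart fun b : Bool => cond b x y
  obtain ⟨x', hx'⟩ : x ∈ Set.range f := hf true
  obtain ⟨y', hy'⟩ : y ∈ Set.range f := hf false
  have : IrreducibleSpace (PrimeSpectrum (MvPolynomial (Fin r) ℂ)) := inferInstance
  obtain ⟨z, -, hz⟩ := this.isPreirreducible_univ (f ⁻¹' U) (f ⁻¹' V)
    (hU.preimage f.continuous) (hV.preimage f.continuous)
    ⟨x', trivial, by change f x' ∈ U; rwa [hx']⟩ ⟨y', trivial, by change f y' ∈ V; rwa [hy']⟩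
  exact ⟨f z, trivial, hz⟩

end Charts

/-! ### From Krull dimension to transcendence degree. -/

section Dimension

/-- Chains of primes lift by lying over and going up. -/
theorem ringKrullDim_le_of_isIntegral {A B : Type} [CommRing A] [CommRing B] (g : A →+* B)
    (hg : g.IsIntegral) (hinj : Function.Injective g) : ringKrullDim A ≤ ringKrullDim B := by
  algebraize [g]
  have : Algebra.IsIntegral A B := ⟨hg⟩
  have hlift : ∀ n (s : LTSeries (PrimeSpectrum A)), s.length = n →
      ∃ t : LTSeries (PrimeSpectrum B), t.length = n ∧ PrimeSpectrum.comap (algebraMap A B) t.last = s.last := by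
    rintro _ s rfl
    induction s using RelSeries.inductionOn' with
    | singleton p =>
      obtain ⟨Q, -, hQ, hQp⟩ := Ideal.exists_ideal_over_prime_of_isIntegral (S := B) p.asIdeal ⊥ (by
        rw [← RingHom.ker_eq_comap_bot]
        exact ((RingHom.injective_iff_ker_eq_bot _).mp hinj).le.trans bot_le)
      exact ⟨RelSeries.singleton _ ⟨Q, hQ⟩, rfl, PrimeSpectrum.ext hQp⟩
    | snoc s p hp ih =>
      obtain ⟨t, ht, hts⟩ := ih
      obtain ⟨Q, hle, hQ, hQp⟩ := Ideal.exists_ideal_over_prime_of_isIntegral (S := B) p.asIdeal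
        t.last.asIdeal (by
          have := congrArg PrimeSpectrum.asIdeal hts
          rw [PrimeSpectrum.comap_asIdeal] at this
          rw [this]
          exact le_of_lt hp)
      have hlt : t.last < ⟨Q, hQ⟩ := by
        refine lt_of_le_of_ne hle fun h => ne_of_lt (show s.last < p from hp) ?_
        rw [← hts, h]
        exact PrimeSpectrum.ext hQp
      exact ⟨t.snoc ⟨Q, hQ⟩ hlt, by simp [ht], by simpa using PrimeSpectrum.ext hQp⟩
  refine iSup_le fun s => ?_
  obtain ⟨t, ht, -⟩ := hlift _ s rfl
  rw [← ht]
  exact le_iSup (fun t : LTSeries (PrimeSpectrum B) => (t.length : WithBot ℕ∞)) t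

/-- Noether normalization makes `ℂ[c]` integral over a polynomial ring in `s` variables. So `s` is
at most the dimension, and `K` is algebraic over `s` elements. -/
theorem natCard_le_ringKrullDim_of_algebraicIndependent {K : Type} [Field K] [Algebra ℂ K] {σ τ : Type}
    [Finite σ] [Finite τ] {c : σ → K} (hc : IntermediateField.adjoin ℂ (Set.range c) = ⊤)
    {t : τ → K} (ht : AlgebraicIndependent ℂ t) :
    (Nat.card τ : WithBot ℕ∞) ≤ ringKrullDim (Algebra.adjoin ℂ (Set.range c)) := by
  have : Algebra.FiniteType ℂ (Algebra.adjoin ℂ (Set.range c)) :=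
    (Subalgebra.fg_iff_finiteType _).mp (Subalgebra.fg_def.mpr ⟨_, Set.finite_range c, rfl⟩)
  obtain ⟨s, g, hg, hint⟩ := exists_integral_inj_algHom_of_fg ℂ (Algebra.adjoin ℂ (Set.range c))
  have hs : (s : WithBot ℕ∞) ≤ ringKrullDim (Algebra.adjoin ℂ (Set.range c)) := by
    refine le_trans ?_ (ringKrullDim_le_of_isIntegral _ hint hg)
    rw [MvPolynomial.ringKrullDim_of_isNoetherianRing, ringKrullDim_eq_zero_of_field]
    simp
  refine le_trans ?_ hs
  let B : Set K := Set.range fun k : Fin s => (g (X k) : K)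
  have hgB (p : MvPolynomial (Fin s) ℂ) : (g p : K) ∈ Algebra.adjoin ℂ B := by
    have : ((Algebra.adjoin ℂ (Set.range c)).val.comp g) = aeval fun k => (g (X k) : K) := by
      ext k; simp
    rw [show (g p : K) = aeval (fun k => (g (X k) : K)) p from congr($this p),
      Algebra.adjoin_range_eq_range_aeval]
    exact ⟨p, rfl⟩
  have halg : Algebra.IsAlgebraic (Algebra.adjoin ℂ B) K := by
    let T : IntermediateField ℂ K := Subalgebra.toIntermediateField
      ((Subalgebra.algebraicClosure (Algebra.adjoin ℂ B) K).restrictScalars ℂ)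
      fun z hz => IsAlgebraic.inv hz
    have hle : IntermediateField.adjoin ℂ (Set.range c) ≤ T := by
      rw [IntermediateField.adjoin_le_iff]
      rintro _ ⟨m, rfl⟩
      obtain ⟨p, hp, hp0⟩ := hint ⟨c m, Algebra.subset_adjoin ⟨m, rfl⟩⟩
      refine IsIntegral.isAlgebraic (R := Algebra.adjoin ℂ B) ?_
      let g' : MvPolynomial (Fin s) ℂ →+* Algebra.adjoin ℂ B :=
        ((Algebra.adjoin ℂ (Set.range c)).val.comp g).toRingHom.codRestrict _ hgB
      refine ⟨p.map g', hp.map _, ?_⟩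
      rw [Polynomial.eval₂_map]
      have := congr((Algebra.adjoin ℂ (Set.range c)).val $hp0)
      rw [map_zero] at this
      rw [← this]
      refine Eq.trans ?_ (Polynomial.hom_eval₂ p g.toRingHom (Algebra.adjoin ℂ (Set.range c)).val.toRingHom _).symm
      rfl
    rw [hc] at hle
    exact ⟨fun z => hle (IntermediateField.mem_top (x := z))⟩
  have h1 := ht.cardinalMk_le_trdeg
  have h2 := h1.trans (Algebra.IsAlgebraic.trdeg_le_cardinalMk ℂ B)
  have h3 := h2.trans Cardinal.mk_range_le
  have h4 := Cardinal.toNat_le_toNat h3 (Cardinal.mk_lt_aleph0)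
  have h5 : Nat.card τ ≤ s := by simpa [Nat.card] using h4
  exact_mod_cast h5

/-- `Spec ℂ[c]` is the closure of `x` inside the chart, so it embeds topologically into `X` and has
dimension at most `r - 2`, while `τ` has at least `r - 1` elements. -/
theorem not_algebraicIndependent_of_topologicalKrullDim_add_two_le {r : ℕ} {X : Scheme.{0}}
    (i : X ⟶ Cremona.ProjSpace r) [IsClosedImmersion i] (hX : topologicalKrullDim X + 2 ≤ r)
    {K : Type} [Field K] [Algebra ℂ K] {c : Fin r → K}
    (hc : IntermediateField.adjoin ℂ (Set.range c) = ⊤)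
    (f : Spec (CommRingCat.of (MvPolynomial (Fin r) ℂ)) ⟶ Cremona.ProjSpace r) [IsOpenImmersion f]
    {x : X} (hx : f (affinePoint c) = i x) {τ : Type} [Finite τ] (hτ : r ≤ Nat.card τ + 1)
    (t : τ → K) : ¬ AlgebraicIndependent ℂ t := by
  intro ht
  have h1 := natCard_le_ringKrullDim_of_algebraicIndependent hc ht
  have h2 : ringKrullDim (Algebra.adjoin ℂ (Set.range c)) ≤ topologicalKrullDim X := by
    let φ : MvPolynomial (Fin r) ℂ →+* Algebra.adjoin ℂ (Set.range c) :=
      (aeval c : MvPolynomial (Fin r) ℂ →ₐ[ℂ] K).toRingHom.codRestrict _ fun p => by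
        rw [Algebra.adjoin_range_eq_range_aeval]; exact ⟨p, rfl⟩
    have hφ : Function.Surjective φ := by
      rintro ⟨z, hz⟩
      rw [Algebra.adjoin_range_eq_range_aeval] at hz
      obtain ⟨p, rfl⟩ := hz
      exact ⟨p, rfl⟩
    rw [← PrimeSpectrum.topologicalKrullDim_eq_ringKrullDim]
    have hind : Topology.IsInducing (f ∘ PrimeSpectrum.comap φ) :=
      f.isOpenEmbedding.isInducing.comp
        (PrimeSpectrum.isClosedEmbedding_comap_of_surjective _ φ hφ).isInducing
    have hrange (q) : ∃ y, i y = f (PrimeSpectrum.comap φ q) := by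
      have h3 (p : MvPolynomial (Fin r) ℂ) (hp : p ∈ PrimeSpectrum.asIdeal (affinePoint c)) :
          p ∈ (PrimeSpectrum.comap φ q).asIdeal := by
        have h5 : aeval c p = 0 := by
          by_contra h
          exact (IsLocalRing.notMem_maximalIdeal.mpr (IsUnit.mk0 _ h)) hp
        have h6 : φ p = 0 := Subtype.ext h5
        change φ p ∈ q.asIdeal
        rw [h6]
        exact zero_mem _
      have h4 : f (affinePoint c) ⤳ f (PrimeSpectrum.comap φ q) :=
        ((PrimeSpectrum.le_iff_specializes (R := MvPolynomial (Fin r) ℂ) _ _).mp h3).map f.continuous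
      rw [hx] at h4
      exact h4.mem_closed i.isClosedEmbedding.isClosed_range ⟨x, rfl⟩
    choose y hy using hrange
    have : Topology.IsInducing y := by
      rw [← i.isClosedEmbedding.isInducing.of_comp_iff]
      convert hind using 1
      exact funext hy
    exact this.topologicalKrullDim_le
  have h3 := (add_le_add_left (h1.trans h2) 2).trans hX
  have h4 : Nat.card τ + 2 ≤ r := by exact_mod_cast h3
  omega

end Dimension

/-! ### Field-valued points and their coordinates. -/

section FieldPoints

attribute [local instance] MvPolynomial.gradedAlgebra

/-- Surjectivity on the stalk at the point of `Spec K` says that every element of `K` is a quotient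
of polynomials in `c`. -/
theorem MvPolynomial.adjoin_range_eq_top_of_isPreimmersion {σ K : Type} [Field K] [Algebra ℂ K]
    (c : σ → K) (h : IsPreimmersion (Spec.map (CommRingCat.ofHom
      (aeval c : MvPolynomial σ ℂ →ₐ[ℂ] K).toRingHom))) :
    IntermediateField.adjoin ℂ (Set.range c) = ⊤ := by
  have h1 := ((IsPreimmersion.SpecMap_iff _).mp h).2
  rw [RingHom.SurjectiveOnStalks] at h1
  have h2 := (RingHom.surjective_localRingHom_iff _).mp
    (h1 (⊥ : Ideal K) (inferInstanceAs (⊥ : Ideal K).IsPrime))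
  rw [eq_top_iff]
  rintro s -
  obtain ⟨x, y, a, ha, hy, hxy⟩ := h2 s
  rw [IntermediateField.mem_adjoin_range_iff]
  refine ⟨x, y, ?_⟩
  have ha' : a ≠ 0 := fun h => ha (by rw [h]; exact zero_mem _)
  have hy' : aeval c y ≠ 0 := fun h => hy (by change aeval c y ∈ _; rw [h]; exact zero_mem _)
  rw [eq_div_iff hy']
  have h3 : a * (aeval c y * s) = a * aeval c x := by rw [← mul_assoc]; exact hxy
  rw [mul_comm, mul_left_cancel₀ ha' h3]

theorem exists_coordinates {r : ℕ} {K : Type} [Field K] [Algebra ℂ K]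
    (g : Spec (CommRingCat.of K) ⟶ Cremona.ProjSpace r)
    (hg : g ≫ Cremona.structureMap r = Spec.map (CommRingCat.ofHom (algebraMap ℂ K)))
    (f : Spec (CommRingCat.of (MvPolynomial (Fin r) ℂ)) ⟶ Cremona.ProjSpace r) [IsOpenImmersion f]
    (hf : f ≫ Cremona.structureMap r = affineStructureMap (Fin r))
    (hgf : g (IsLocalRing.closedPoint K) ∈ Set.range f) :
    ∃ c : Fin r → K, Spec.map (CommRingCat.ofHom
      (aeval c : MvPolynomial (Fin r) ℂ →ₐ[ℂ] K).toRingHom) ≫ f = g := by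
  have hrange : Set.range g ⊆ Set.range f := by
    rintro _ ⟨z, rfl⟩
    rwa [Subsingleton.elim z (IsLocalRing.closedPoint K : PrimeSpectrum K)]
  obtain ⟨φ, hφ⟩ := Spec.map_surjective (IsOpenImmersion.lift f g hrange)
  have h1 : Spec.map φ ≫ f = g := by rw [hφ, IsOpenImmersion.lift_fac]
  have h2 : φ.hom.comp (algebraMap ℂ (MvPolynomial (Fin r) ℂ)) = algebraMap ℂ K := by
    rw [← h1, Category.assoc, hf, affineStructureMap, ← Spec.map_comp] at hg
    exact congrArg CommRingCat.Hom.hom (Spec.map_injective hg)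
  refine ⟨fun m => φ.hom (X m), ?_⟩
  rw [← h1]
  congr 2
  ext1
  refine MvPolynomial.ringHom_ext (fun z => ?_) fun m => ?_
  · have := congr($h2 z)
    simpa using this.symm
  · simp

theorem separatedPoints_of_not_specializes {ι σ : Type} {K : ι → Type} [∀ i, Field (K i)]
    [∀ i, Algebra ℂ (K i)] (c : ∀ i, σ → K i)
    (h : ∀ i j, i ≠ j → ¬ affinePoint (c i) ⤳ affinePoint (c j)) : SeparatedPoints c := by
  intro i j hij
  by_contra! H
  refine h j i hij.symm ?_
  refine (PrimeSpectrum.le_iff_specializes (R := MvPolynomial σ ℂ) _ _).mp fun p hp => ?_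
  have hp' : aeval (c j) p = 0 := by
    by_contra h
    exact (IsLocalRing.notMem_maximalIdeal.mpr (IsUnit.mk0 _ h)) hp
  have h2 : aeval (c i) p = 0 := by
    by_contra h
    exact H p h hp'
  change aeval (c i) p ∈ IsLocalRing.maximalIdeal (K i)
  rw [h2]
  exact zero_mem _

/-- Two families of points of projective space with isomorphic residue fields correspond under an
isomorphism of open subschemes if the residue fields have small transcendence degree. -/
theorem linked_of_isPreimmersion {r : ℕ} (hr : 2 ≤ r) {ι : Type} [Finite ι] {K : ι → Type}
    [∀ i, Field (K i)] [∀ i, Algebra ℂ (K i)]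
    (g g' : ∀ i, Spec (CommRingCat.of (K i)) ⟶ Cremona.ProjSpace r)
    [∀ i, IsPreimmersion (g i)] [∀ i, IsPreimmersion (g' i)]
    (hg : ∀ i, g i ≫ Cremona.structureMap r = Spec.map (CommRingCat.ofHom (algebraMap ℂ (K i))))
    (hg' : ∀ i, g' i ≫ Cremona.structureMap r = Spec.map (CommRingCat.ofHom (algebraMap ℂ (K i))))
    (hs : ∀ i j, i ≠ j → ¬ g i (IsLocalRing.closedPoint (K i)) ⤳ g j (IsLocalRing.closedPoint (K j)))
    (hs' : ∀ i j, i ≠ j →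
      ¬ g' i (IsLocalRing.closedPoint (K i)) ⤳ g' j (IsLocalRing.closedPoint (K j)))
    (htr : ∀ i (τ : Type) [Finite τ], r ≤ Nat.card τ + 1 → ∀ t : τ → K i,
      ¬ AlgebraicIndependent ℂ t) :
    Linked (Cremona.structureMap r) (Cremona.structureMap r)
      (fun i => g i (IsLocalRing.closedPoint (K i)))
      (fun i => g' i (IsLocalRing.closedPoint (K i))) := by
  have key (g : ∀ i, Spec (CommRingCat.of (K i)) ⟶ Cremona.ProjSpace r)
      [∀ i, IsPreimmersion (g i)]
      (hg : ∀ i, g i ≫ Cremona.structureMap r = Spec.map (CommRingCat.ofHom (algebraMap ℂ (K i))))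
      (hs : ∀ i j, i ≠ j →
        ¬ g i (IsLocalRing.closedPoint (K i)) ⤳ g j (IsLocalRing.closedPoint (K j))) :
      ∃ c : ∀ i, Fin r → K i, SeparatedPoints c ∧ GeneratingTuples c ∧
        Linked (affineStructureMap (Fin r)) (Cremona.structureMap r) (fun i => affinePoint (c i))
          (fun i => g i (IsLocalRing.closedPoint (K i))) := by
    obtain ⟨f, hf, hfs, hfr⟩ := exists_chart fun i => g i (IsLocalRing.closedPoint (K i))
    choose c hc using fun i => exists_coordinates (g i) (hg i) f hfs (hfr i)
    have hpt (i) : f (affinePoint (c i)) = g i (IsLocalRing.closedPoint (K i)) := by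
      rw [← hc i]; exact (Scheme.Hom.comp_apply _ _ _).symm
    refine ⟨c, separatedPoints_of_not_specializes c fun i j hij h => hs i j hij ?_, fun i => ?_,
      _, 𝟙 _, f, inferInstance, hf, by simp [hfs], fun i => affinePoint (c i), fun i => rfl, hpt⟩
    · rw [← hpt, ← hpt]
      exact h.map f.continuous
    · have : IsPreimmersion (Spec.map (CommRingCat.ofHom
          (aeval (c i) : MvPolynomial (Fin r) ℂ →ₐ[ℂ] K i).toRingHom) ≫ f) := by
        rw [hc i]; infer_instance
      exact adjoin_range_eq_top_of_isPreimmersion (c i) (IsPreimmersion.of_comp _ f)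
  obtain ⟨c, hc1, hc2, hc3⟩ := key g hg hs
  obtain ⟨d, hd1, hd2, hd3⟩ := key g' hg' hs'
  have hpq : (⟨0, by omega⟩ : Fin r) ≠ ⟨1, by omega⟩ := by simp
  refine (hc3.symm.trans (CoordLinked.of_separatedPoints hpq hc1 hc2 hd1 hd2 fun i t =>
    htr i _ ?_ t)).trans hd3
  simp only [Nat.card_eq_fintype_card, Fintype.card_subtype_compl, Fintype.card_fin,
    Fintype.card_subtype_eq]
  omega

end FieldPoints

/-! ### Generic points of irreducible components. -/

section GenericPoints

attribute [local instance] MvPolynomial.gradedAlgebra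

theorem exists_genericPoints_specializes {T : Type} [TopologicalSpace T] [QuasiSober T] (z : T) :
    ∃ x ∈ genericPoints T, x ⤳ z := by
  let Z : irreducibleComponents T :=
    ⟨irreducibleComponent z, irreducibleComponent_mem_irreducibleComponents z⟩
  let x := genericPoints.ofComponent Z
  refine ⟨x, x.2, ?_⟩
  rw [specializes_iff_mem_closure]
  have : closure {(x : T)} = irreducibleComponent z := genericPoints.isGenericPoint_ofComponent Z
  rw [this]
  exact mem_irreducibleComponent

theorem eq_of_mem_genericPoints {T : Type} [TopologicalSpace T] [T0Space T] {x y : T}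
    (hy : y ∈ genericPoints T) (h : x ⤳ y) : x = y := by
  have h1 : closure {y} ⊆ closure {x} :=
    closure_minimal (Set.singleton_subset_iff.mpr h.mem_closure) isClosed_closure
  have h2 : closure {x} ⊆ closure {y} := by
    exact Maximal.le_of_ge hy isIrreducible_singleton.closure h1
  exact (h.antisymm (specializes_iff_closure_subset.mpr h2)).eq

/-- An open set missing `x` lies in the closed union of the closures of the finitely many other
generic points, so it is not dense. -/
theorem mem_of_mem_genericPoints {T : Type} [TopologicalSpace T] [T0Space T] [QuasiSober T]
    (hfin : (genericPoints T).Finite) {U : Set T} (hU : IsOpen U) (hd : Dense U) {x : T}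
    (hx : x ∈ genericPoints T) : x ∈ U := by
  by_contra hxU
  have h1 : U ⊆ ⋃ y ∈ genericPoints T \ {x}, closure {y} := by
    intro u hu
    obtain ⟨y, hy, hyu⟩ := exists_genericPoints_specializes u
    refine Set.mem_biUnion ⟨hy, ?_⟩ hyu.mem_closure
    rintro rfl
    exact hxU (hyu.mem_open hU hu)
  have h2 : closure U ⊆ ⋃ y ∈ genericPoints T \ {x}, closure {y} :=
    closure_minimal h1 ((hfin.subset Set.sdiff_subset).isClosed_biUnion fun _ _ => isClosed_closure)
  rw [hd.closure_eq] at h2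
  obtain ⟨y, ⟨-, hyx⟩, hy⟩ := Set.mem_iUnion₂.mp (h2 (Set.mem_univ x))
  exact hyx (eq_of_mem_genericPoints hx (specializes_iff_mem_closure.mpr hy))

instance (r : ℕ) : TopologicalSpace.NoetherianSpace (Cremona.ProjSpace r) := by
  have h1 : Function.Surjective
      (algebraMap ℂ (homogeneousSubmodule (Fin (r + 1)) ℂ 0)) := by
    rintro ⟨p, hp⟩
    refine ⟨coeff 0 p, Subtype.ext ?_⟩
    exact (totalDegree_eq_zero_iff_eq_C.mp ((totalDegree_zero_iff_isHomogeneous ..).mpr hp)).symm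
  have : IsNoetherianRing (homogeneousSubmodule (Fin (r + 1)) ℂ 0) :=
    isNoetherianRing_of_surjective _ _ _ h1
  have : Algebra.FiniteType (homogeneousSubmodule (Fin (r + 1)) ℂ 0)
      (MvPolynomial (Fin (r + 1)) ℂ) :=
    have : IsScalarTower ℂ (homogeneousSubmodule (Fin (r + 1)) ℂ 0)
        (MvPolynomial (Fin (r + 1)) ℂ) :=
      ⟨fun a b c => smul_mul_assoc a (b : MvPolynomial (Fin (r + 1)) ℂ) c⟩
    Algebra.FiniteType.of_restrictScalars_finiteType ℂ _ _
  have := LocallyOfFiniteType.isLocallyNoetherian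
    (Proj.toSpecZero (homogeneousSubmodule (Fin (r + 1)) ℂ))
  have : CompactSpace (Cremona.ProjSpace r) :=
    QuasiCompact.compactSpace_of_compactSpace (Proj.toSpecZero (homogeneousSubmodule (Fin (r + 1)) ℂ))
  have : IsNoetherian (Cremona.ProjSpace r) := { }
  infer_instance

theorem finite_genericPoints {r : ℕ} {X : Scheme.{0}} (i : X ⟶ Cremona.ProjSpace r)
    [IsClosedImmersion i] : (genericPoints X).Finite := by
  have : TopologicalSpace.NoetherianSpace X :=
    i.isClosedEmbedding.isInducing.noetherianSpace
  exact genericPoints.finite TopologicalSpace.NoetherianSpace.finite_irreducibleComponents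

end GenericPoints

/-! ### Points and residue fields under partial isomorphisms. -/

namespace AlgebraicGeometry.Scheme.PartialIso

variable {X Y S : Scheme.{0}}

/-- The image of a point of the source under a partial isomorphism. -/
noncomputable def imagePoint (φ : X.PartialIso Y) {x : X} (hx : x ∈ φ.source) : Y :=
  φ.target.ι (φ.iso.hom ⟨x, hx⟩)

theorem specializes_imagePoint_iff (φ : X.PartialIso Y) {x x' : X} (hx : x ∈ φ.source)
    (hx' : x' ∈ φ.source) : φ.imagePoint hx ⤳ φ.imagePoint hx' ↔ x ⤳ x' := by
  have h : ∀ u u' : φ.source.toScheme, φ.target.ι (φ.iso.hom u) ⤳ φ.target.ι (φ.iso.hom u') ↔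
      φ.source.ι u ⤳ φ.source.ι u' := fun u u' => by
    rw [φ.target.ι.isOpenEmbedding.isInducing.specializes_iff,
      φ.iso.hom.isOpenEmbedding.isInducing.specializes_iff,
      φ.source.ι.isOpenEmbedding.isInducing.specializes_iff]
  exact h ⟨x, hx⟩ ⟨x', hx'⟩

end AlgebraicGeometry.Scheme.PartialIso

namespace AlgebraicGeometry.Scheme

/-- The morphism from the spectrum of the residue field at a point to an open neighbourhood. -/
noncomputable def Opens.fromSpecResidueField {X : Scheme.{0}} (U : X.Opens) {x : X} (hx : x ∈ U) :
    Spec (X.residueField x) ⟶ U.toScheme :=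
  IsOpenImmersion.lift U.ι (X.fromSpecResidueField x) (by
    rw [range_fromSpecResidueField]
    simpa using hx)

theorem Opens.fromSpecResidueField_ι {X : Scheme.{0}} (U : X.Opens) {x : X} (hx : x ∈ U) :
    U.fromSpecResidueField hx ≫ U.ι = X.fromSpecResidueField x :=
  IsOpenImmersion.lift_fac _ _ _

instance {X : Scheme.{0}} (U : X.Opens) {x : X} (hx : x ∈ U) :
    IsPreimmersion (U.fromSpecResidueField hx) := by
  have : IsPreimmersion (U.fromSpecResidueField hx ≫ U.ι) := by
    rw [Opens.fromSpecResidueField_ι]; infer_instance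
  exact IsPreimmersion.of_comp _ U.ι

theorem Opens.fromSpecResidueField_apply {X : Scheme.{0}} (U : X.Opens) {x : X} (hx : x ∈ U)
    (s : Spec (X.residueField x)) : U.fromSpecResidueField hx s = ⟨x, hx⟩ := by
  apply U.ι.isOpenEmbedding.injective
  refine (Scheme.Hom.comp_apply _ _ _).symm.trans ?_
  rw [Opens.fromSpecResidueField_ι, Scheme.fromSpecResidueField_apply]
  rfl

end AlgebraicGeometry.Scheme

namespace AlgebraicGeometry.Scheme.PartialIso

variable {X Y S : Scheme.{0}}

/-- The morphism from the spectrum of the residue field at a point of the source to the target. -/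
noncomputable def fromSpecResidueField (φ : X.PartialIso Y) {x : X} (hx : x ∈ φ.source) :
    Spec (X.residueField x) ⟶ Y :=
  φ.source.fromSpecResidueField hx ≫ φ.iso.hom ≫ φ.target.ι

instance (φ : X.PartialIso Y) {x : X} (hx : x ∈ φ.source) :
    IsPreimmersion (φ.fromSpecResidueField hx) := by
  rw [fromSpecResidueField]
  infer_instance

theorem fromSpecResidueField_apply (φ : X.PartialIso Y) {x : X} (hx : x ∈ φ.source)
    (s : Spec (X.residueField x)) : φ.fromSpecResidueField hx s = φ.imagePoint hx := by
  rw [fromSpecResidueField, Scheme.Hom.comp_apply, Scheme.Hom.comp_apply,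
    Opens.fromSpecResidueField_apply]
  rfl

theorem IsOver.fromSpecResidueField_comp {φ : X.PartialIso Y} {sX : X ⟶ S} {sY : Y ⟶ S}
    (h : φ.IsOver sX sY) {x : X} (hx : x ∈ φ.source) :
    φ.fromSpecResidueField hx ≫ sY = X.fromSpecResidueField x ≫ sX := by
  rw [PartialIso.fromSpecResidueField, Category.assoc, Category.assoc, h,
    ← Category.assoc, Opens.fromSpecResidueField_ι]

end AlgebraicGeometry.Scheme.PartialIso

/-! ### Birational subschemes are Cremona equivalent. -/

namespace Cremona

theorem CremonaEquivalent.of_isEmpty {r : ℕ} {X Y : Scheme.{0}} (i : X ⟶ ProjSpace r)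
    (j : Y ⟶ ProjSpace r) [IsEmpty X] [IsEmpty Y] : CremonaEquivalent i j := by
  refine ⟨.refl _, ?_, fun x => isEmptyElim x, ?_⟩
  · exact Category.id_comp _
  · rw [birationalImage, Set.range_eq_empty, Set.range_eq_empty]
    simp

/-- Specialization is preserved by `ω`, so matching the generic points of `X` with points whose
closures cover `Y` determines the image. -/
theorem CremonaEquivalent.of_linked {r : ℕ} {X Y : Scheme.{0}} (i : X ⟶ ProjSpace r)
    (j : Y ⟶ ProjSpace r) [IsClosedImmersion j] [Nonempty (genericPoints X)]
    (y : genericPoints X → Y) (hy : ∀ z, ∃ x, y x ⤳ z)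
    (h : Linked (structureMap r) (structureMap r) (fun x : genericPoints X => i x)
      (fun x => j (y x))) : CremonaEquivalent i j := by
  obtain ⟨ω, hω, hωp⟩ := h.exists_partialIso
  refine ⟨ω, hω, fun x hx => ?_, ?_⟩
  · obtain ⟨u, hu, -⟩ := hωp ⟨x, hx⟩
    rw [← hu]
    exact u.2
  · refine (closure_minimal ?_ j.isClosedEmbedding.isClosed_range).antisymm ?_
    · rintro _ ⟨u, ⟨z, hz⟩, rfl⟩
      obtain ⟨x, hx, hxz⟩ := exists_genericPoints_specializes z
      obtain ⟨u', hu', hu'y⟩ := hωp ⟨x, hx⟩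
      have h1 : u' ⤳ u := ω.source.ι.isOpenEmbedding.isInducing.specializes_iff.mp (by
        rw [hu', ← hz]
        exact hxz.map i.continuous)
      have h2 := (h1.map ω.iso.hom.continuous).map ω.target.ι.continuous
      rw [hu'y] at h2
      exact h2.mem_closed j.isClosedEmbedding.isClosed_range ⟨_, rfl⟩
    · rintro _ ⟨z, rfl⟩
      obtain ⟨x, hx⟩ := hy z
      obtain ⟨u, hu, huy⟩ := hωp x
      refine (hx.map j.continuous).mem_closed isClosed_closure (subset_closure ⟨u, ⟨x, hu.symm⟩, huy⟩)

theorem CremonaEquivalent.of_birationalOver {r : ℕ} {X Y : Scheme.{0}} (i : X ⟶ ProjSpace r)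
    (j : Y ⟶ ProjSpace r) [IsClosedImmersion i] [IsClosedImmersion j]
    (hX : topologicalKrullDim X + 2 ≤ r)
    (h : Scheme.BirationalOver (i ≫ structureMap r) (j ≫ structureMap r)) :
    CremonaEquivalent i j := by
  obtain ⟨φ, hφ⟩ := h
  -- The empty scheme has dimension `⊥`, so in that case the hypothesis gives no bound on `r`.
  rcases isEmpty_or_nonempty X with hX0 | hX0
  · have : IsEmpty φ.target.toScheme := ⟨fun v => hX0.elim (φ.source.ι (φ.iso.inv v))⟩
    have : IsEmpty Y := by
      refine ⟨fun y => ?_⟩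
      obtain ⟨z, hz⟩ := φ.dense_target.nonempty_iff.mpr ⟨y⟩
      exact this.elim ⟨z, hz⟩
    exact .of_isEmpty i j
  have hr : 2 ≤ r := by
    obtain ⟨x⟩ := hX0
    have : Nonempty (TopologicalSpace.IrreducibleCloseds X) :=
      ⟨⟨closure {x}, isIrreducible_singleton.closure, isClosed_closure⟩⟩
    have h1 : 0 ≤ topologicalKrullDim X := Order.krullDim_nonneg
    have h2 := (add_le_add_left h1 2).trans hX
    rw [zero_add] at h2
    exact_mod_cast h2
  have hfin := finite_genericPoints i
  have : Finite (genericPoints X) := hfin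
  obtain ⟨x₀⟩ := hX0
  obtain ⟨x₁, hx₁, -⟩ := exists_genericPoints_specializes x₀
  have : Nonempty (genericPoints X) := ⟨⟨x₁, hx₁⟩⟩
  have hsource (x : genericPoints X) : (x : X) ∈ φ.source :=
    mem_of_mem_genericPoints hfin φ.source.isOpen φ.dense_source x.2
  letI (x : genericPoints X) : Algebra ℂ (X.residueField x) :=
    (Spec.preimage (X.fromSpecResidueField x ≫ i ≫ structureMap r)).hom.toAlgebra
  have halg (x : genericPoints X) : Spec.map (CommRingCat.ofHom (algebraMap ℂ (X.residueField x))) =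
      X.fromSpecResidueField x ≫ i ≫ structureMap r := Spec.map_preimage _
  let g (x : genericPoints X) : Spec (CommRingCat.of (X.residueField x)) ⟶ ProjSpace r :=
    X.fromSpecResidueField x ≫ i
  let g' (x : genericPoints X) : Spec (CommRingCat.of (X.residueField x)) ⟶ ProjSpace r :=
    φ.fromSpecResidueField (hsource x) ≫ j
  have hg (x : genericPoints X) : g x (IsLocalRing.closedPoint (X.residueField x)) = i x := by
    refine (Scheme.Hom.comp_apply _ _ _).trans ?_
    exact congrArg i (X.fromSpecResidueField_apply x _)
  have hg' (x : genericPoints X) :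
      g' x (IsLocalRing.closedPoint (X.residueField x)) = j (φ.imagePoint (hsource x)) := by
    refine (Scheme.Hom.comp_apply _ _ _).trans ?_
    exact congrArg j (φ.fromSpecResidueField_apply (hsource x) _)
  have hi (x) : IsPreimmersion (g x) :=
    inferInstanceAs (IsPreimmersion (X.fromSpecResidueField x ≫ i))
  have hi' (x) : IsPreimmersion (g' x) :=
    inferInstanceAs (IsPreimmersion (φ.fromSpecResidueField (hsource x) ≫ j))
  have hover (x) : g x ≫ structureMap r =
      Spec.map (CommRingCat.ofHom (algebraMap ℂ (X.residueField x))) := by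
    rw [halg, Category.assoc]
  have hover' (x) : g' x ≫ structureMap r =
      Spec.map (CommRingCat.ofHom (algebraMap ℂ (X.residueField x))) := by
    rw [halg, Category.assoc, hφ.fromSpecResidueField_comp]
  have hspec (x x' : genericPoints X) (hne : x ≠ x') : ¬ (x : X) ⤳ x' :=
    fun h => hne (Subtype.ext (eq_of_mem_genericPoints x'.2 h))
  have hlink := linked_of_isPreimmersion hr g g' hover hover'
    (fun x x' hne h => by
      rw [hg, hg, i.isClosedEmbedding.isInducing.specializes_iff] at h
      exact hspec x x' hne h)
    (fun x x' hne h => by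
      rw [hg', hg', j.isClosedEmbedding.isInducing.specializes_iff,
        φ.specializes_imagePoint_iff] at h
      exact hspec x x' hne h)
    (fun x τ _ hτ t => by
      obtain ⟨f, hf, hfs, hfr⟩ := exists_chart fun _ : Unit => i x
      obtain ⟨c, hc⟩ := exists_coordinates (g x) (hover x) f hfs (by rw [hg]; exact hfr ())
      have : IsPreimmersion (Spec.map (CommRingCat.ofHom
          (aeval c : MvPolynomial (Fin r) ℂ →ₐ[ℂ] X.residueField x).toRingHom) ≫ f) := by
        rw [hc]; exact hi x
      refine not_algebraicIndependent_of_topologicalKrullDim_add_two_le i hX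
        (adjoin_range_eq_top_of_isPreimmersion c (IsPreimmersion.of_comp _ f)) f (x := x) ?_ hτ t
      rw [← hg x, ← hc]
      exact (Scheme.Hom.comp_apply _ _ _).symm)
  simp only [hg, hg'] at hlink
  -- The closures of the images of the generic points cover the target of `φ`; the union is finite,
  -- hence closed, and so covers `Y`.
  have hcl : (φ.target : Set Y) ⊆ ⋃ x : genericPoints X, closure {φ.imagePoint (hsource x)} := by
    intro v hv
    obtain ⟨x, hx, hxu⟩ := exists_genericPoints_specializes (φ.source.ι (φ.iso.inv ⟨v, hv⟩))
    refine Set.mem_iUnion.mpr ⟨⟨x, hx⟩, specializes_iff_mem_closure.mp ?_⟩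
    have hu : φ.source.ι (φ.iso.inv ⟨v, hv⟩) ∈ φ.source := (φ.iso.inv ⟨v, hv⟩).2
    have hv' : v = φ.imagePoint hu := by
      have h : ∀ w : φ.target.toScheme, φ.target.ι w = φ.target.ι (φ.iso.hom (φ.iso.inv w)) :=
        fun w => by rw [← Scheme.Hom.comp_apply φ.iso.inv, Iso.inv_hom_id]; rfl
      exact h ⟨v, hv⟩
    rw [hv']
    exact (φ.specializes_imagePoint_iff _ _).mpr hxu
  refine .of_linked i j (fun x => φ.imagePoint (hsource x)) (fun z => ?_) hlink
  have h := closure_minimal hcl (isClosed_iUnion_of_finite fun x => isClosed_closure)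
  rw [φ.dense_target.closure_eq] at h
  obtain ⟨x, hx⟩ := Set.mem_iUnion.mp (h (Set.mem_univ z))
  exact ⟨x, specializes_iff_mem_closure.mpr hx⟩

end Cremona

/-! ### Cremona equivalent subschemes are birational. -/

theorem AlgebraicGeometry.Scheme.Hom.ker_eq_vanishingIdeal {U T : Scheme.{0}} [IsReduced U]
    (a : U ⟶ T) : a.ker = Scheme.IdealSheafData.vanishingIdeal (.closure (Set.range a)) := by
  rw [← Scheme.IdealSheafData.map_bot, ← Scheme.nilradical_eq_bot,
    ← Scheme.IdealSheafData.vanishingIdeal_top, Scheme.IdealSheafData.map_vanishingIdeal]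
  congr 2
  exact Set.image_univ

/-- For a reduced source the kernel is the vanishing ideal of the range, so equal ranges give equal
ideal sheaves. -/
theorem AlgebraicGeometry.IsClosedImmersion.exists_iso_of_range_eq {U V T : Scheme.{0}}
    [IsReduced U] [IsReduced V] (a : U ⟶ T) (b : V ⟶ T) [IsClosedImmersion a] [IsClosedImmersion b]
    (h : Set.range a = Set.range b) : ∃ e : U ≅ V, e.hom ≫ b = a := by
  have hker : b.ker = a.ker := by
    rw [a.ker_eq_vanishingIdeal, b.ker_eq_vanishingIdeal, h]
  have := IsClosedImmersion.isIso_lift b a hker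
  exact ⟨asIso (IsClosedImmersion.lift b a hker.le), IsClosedImmersion.lift_fac _ _ _⟩

theorem AlgebraicGeometry.Scheme.Hom.range_morphismRestrict {U T : Scheme.{0}} (a : U ⟶ T)
    (W : T.Opens) : Set.range (a ∣_ W) = W.ι ⁻¹' Set.range a := by
  ext w
  have hpt (u) : W.ι ((a ∣_ W) u) = a ((a ⁻¹ᵁ W).ι u) := by
    rw [← Scheme.Hom.comp_apply, morphismRestrict_ι, Scheme.Hom.comp_apply]
  constructor
  · rintro ⟨u, rfl⟩
    exact ⟨_, (hpt u).symm⟩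
  · rintro ⟨u, hu⟩
    have hu' : u ∈ a ⁻¹ᵁ W := by
      change a u ∈ W
      rw [hu]
      exact w.2
    exact ⟨⟨u, hu'⟩, W.ι.isOpenEmbedding.injective ((hpt _).trans hu)⟩

theorem Cremona.CremonaEquivalent.birationalOver {r : ℕ} {X Y : Scheme.{0}} [IsReduced X]
    [IsReduced Y] (i : X ⟶ ProjSpace r) (j : Y ⟶ ProjSpace r) [IsClosedImmersion i]
    [IsClosedImmersion j] (h : CremonaEquivalent i j) :
    Scheme.BirationalOver (i ≫ structureMap r) (j ≫ structureMap r) := by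
  obtain ⟨ω, hω, hgen, himg⟩ := h
  let a : (i ⁻¹ᵁ ω.source).toScheme ⟶ ω.target.toScheme := (i ∣_ ω.source) ≫ ω.iso.hom
  let b : (j ⁻¹ᵁ ω.target).toScheme ⟶ ω.target.toScheme := j ∣_ ω.target
  have ha : IsClosedImmersion a := inferInstanceAs (IsClosedImmersion (_ ≫ _))
  have hb : IsClosedImmersion b := inferInstanceAs (IsClosedImmersion (j ∣_ ω.target))
  have hS : {q | ∃ u : ω.source, ω.source.ι u ∈ Set.range i ∧ ω.target.ι (ω.iso.hom u) = q} =
      ω.target.ι '' Set.range a := by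
    have ha' : Set.range a = ω.iso.hom '' Set.range (i ∣_ ω.source) := by
      rw [← Set.range_comp]
      congr 1
    rw [ha', Scheme.Hom.range_morphismRestrict]
    ext q
    constructor
    · rintro ⟨u, hu, rfl⟩
      exact ⟨_, ⟨u, hu, rfl⟩, rfl⟩
    · rintro ⟨_, ⟨u, hu, rfl⟩, rfl⟩
      exact ⟨u, hu, rfl⟩
  rw [birationalImage, hS] at himg
  -- Intersecting the closure `ω(X) = Y` with the target adds no points, because the range of `a` is
  -- already closed there.
  have hrange : Set.range a = Set.range b := by
    rw [Scheme.Hom.range_morphismRestrict, ← himg,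
      ← ω.target.ι.isOpenEmbedding.isInducing.closure_eq_preimage_closure_image,
      a.isClosedEmbedding.isClosed_range.closure_eq]
  obtain ⟨e, he⟩ := IsClosedImmersion.exists_iso_of_range_eq a b hrange
  refine ⟨⟨i ⁻¹ᵁ ω.source, ?_, j ⁻¹ᵁ ω.target, ?_, e⟩, ?_⟩
  · intro z
    obtain ⟨x, hx, hxz⟩ := exists_genericPoints_specializes z
    exact hxz.mem_closed isClosed_closure (subset_closure (hgen x hx))
  -- `Y` is the closure of the image of `a`, which equals the image of its own part inside the
  -- target.
  · intro y
    have hy : j y ∈ closure (ω.target.ι '' Set.range b) := by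
      rw [← hrange, himg]
      exact ⟨y, rfl⟩
    rw [j.isClosedEmbedding.isInducing.closure_eq_preimage_closure_image]
    refine closure_mono ?_ hy
    rintro _ ⟨_, ⟨v, rfl⟩, rfl⟩
    refine ⟨(j ⁻¹ᵁ ω.target).ι v, v.2, ?_⟩
    rw [← Scheme.Hom.comp_apply, ← Scheme.Hom.comp_apply, morphismRestrict_ι]
  · change e.hom ≫ (j ⁻¹ᵁ ω.target).ι ≫ j ≫ structureMap r =
      (i ⁻¹ᵁ ω.source).ι ≫ i ≫ structureMap r
    have h1 : (j ⁻¹ᵁ ω.target).ι ≫ j = b ≫ ω.target.ι := (morphismRestrict_ι _ _).symm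
    have h2 : (i ⁻¹ᵁ ω.source).ι ≫ i = (i ∣_ ω.source) ≫ ω.source.ι := (morphismRestrict_ι _ _).symm
    rw [reassoc_of% h1, reassoc_of% h2, reassoc_of% he]
    simp only [a, Category.assoc]
    rw [hω]

theorem theorem1p1 (r : ℕ) (X Y : Scheme.{0}) [IsReduced X] [IsReduced Y]
    (i : X ⟶ Cremona.ProjSpace r) (j : Y ⟶ Cremona.ProjSpace r)
    [IsClosedImmersion i] [IsClosedImmersion j]
    (hX : topologicalKrullDim X + 2 ≤ r) (hY : topologicalKrullDim Y + 2 ≤ r) :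
    Cremona.CremonaEquivalent i j ↔
      Scheme.BirationalOver (i ≫ Cremona.structureMap r) (j ≫ Cremona.structureMap r) :=
  ⟨fun h => h.birationalOver, fun h => .of_birationalOver i j hX h⟩
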